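/- All graphs are finite and simple. For distinct vertices $a,b$ of a graph $G$, the pivot $G^{ab}$ is the graph on the same vertex set obtained as follows: sort the vertices other than $a,b$ that are adjacent to at least one of $a,b$ into three classes (adjacent to $a$ only, to $b$ only, to both), and toggle (edge to non-edge and vice versa) every pair $xy$ with $x$ and $y$ in different classes. The interlace polynomial $q_G\in\mathbb Z[x]$ is the unique graph function with $q_{E_n}=x^n$ for the edgeless graph $E_n$ on $n$ vertices and $q_G=q_{G-a}+q_{G^{ab}-b}$ for every edge $ab$ of $G$. Let $F_0=0$, $F_1=1$, $F_{k+2}=F_{k+1}+F_k$, and let $P_m$ denote the path with $m$ edges (and $m+1$ vertices). (1) If $G$ is a connected graph with $m$ edges, then $q_G(1)\le F_{m+2}$, with equality if and only if $G$ is isomorphic to $P_m$. (2) If $G$ is any graph, with components $G_1,\dots,G_k$ having $m_1,\dots,m_k$ edges, then $q_G(1)\le\prod_{i=1}^k F_{m_i+2}$. (3) If $G$ is any graph with $m$ edges, then $q_G(1)\le 2^m$, with equality if and only if $G$ consists of $m$ independent (pairwise vertex-disjoint) edges and isolated vertices. -/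

import Mathlib

open Polynomial

universe u

namespace InterlacePoly

/-- `x` and `y` are vertices other than `a` and `b`, each adjacent to at least one of `a`, `b`,
and they lie in different classes among: adjacent to `a` alone, adjacent to `b` alone,
adjacent to both. -/
def Distinguished {V : Type u} (G : SimpleGraph V) (a b x y : V) : Prop :=
  x ≠ a ∧ x ≠ b ∧ y ≠ a ∧ y ≠ b ∧ (G.Adj x a ∨ G.Adj x b) ∧ (G.Adj y a ∨ G.Adj y b) ∧
    ¬ ((G.Adj x a ↔ G.Adj y a) ∧ (G.Adj x b ↔ G.Adj y b))

/-- The pivot `G^{ab}`: the pairs of vertices lying in different classes are toggled, all other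
pairs are left as they are. -/
def pivot {V : Type u} (G : SimpleGraph V) (a b : V) : SimpleGraph V where
  Adj x y := Xor (G.Adj x y) (Distinguished G a b x y)
  symm := ⟨by
    intro x y h
    have := G.adj_comm x y
    unfold Distinguished Xor at *
    grind⟩
  loopless := ⟨by
    intro x h
    have := G.irrefl (v := x)
    simp_all [Distinguished, Xor]⟩

open Classical in
/-- The interlace polynomial of the subgraph of `G` induced on the finite vertex set `S`, computed
by pivot reduction about an (arbitrarily chosen) edge `ab`, as long as there is an edge:
`q(G) = q(G - a) + q(G^{ab} - b)`, and `q(E_n) = X ^ n`. The result does not depend on the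
choice of the edge (`interlaceOn_of_adj`). -/
noncomputable def interlaceOn {V : Type u} (G : SimpleGraph V) (S : Finset V) : ℤ[X] :=
  if h : ∃ e : V × V, e.1 ∈ S ∧ e.2 ∈ S ∧ G.Adj e.1 e.2 then
    interlaceOn G (S.erase h.choose.1) +
      interlaceOn (pivot G h.choose.1 h.choose.2) (S.erase h.choose.2)
  else X ^ S.card
termination_by S.card
decreasing_by
  · exact Finset.card_erase_lt_of_mem h.choose_spec.1
  · exact Finset.card_erase_lt_of_mem h.choose_spec.2.1

/-- The interlace polynomial `q(G)` of a finite simple graph `G`: the unique graph function with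
`q(G) = q(G - a) + q(G^{ab} - b)` for every edge `ab` of `G`
(`interlacePolynomial_of_adj`), and `q(E_n) = X ^ n` on the edgeless graph on `n` vertices
(`interlacePolynomial_bot`). -/
noncomputable def interlacePolynomial {V : Type u} [Fintype V] (G : SimpleGraph V) : ℤ[X] :=
  interlaceOn G Finset.univ

theorem pivot_adj {V : Type u} (G : SimpleGraph V) (a b x y : V) :
    (pivot G a b).Adj x y ↔ Xor (G.Adj x y) (Distinguished G a b x y) := Iff.rfl

theorem pivot_comm {V : Type u} (G : SimpleGraph V) (a b : V) : pivot G a b = pivot G b a := by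
  ext x y
  simp only [pivot_adj, Distinguished, Xor]
  grind

/-- Pivoting about `ab` does not change the neighbours of `a`. -/
theorem pivot_adj_left {V : Type u} (G : SimpleGraph V) (a b x : V) :
    (pivot G a b).Adj a x ↔ G.Adj a x := by
  simp only [pivot_adj, Distinguished, Xor]
  grind

theorem pivot_congr {V W : Type u} {G : SimpleGraph V} {H : SimpleGraph W} {S : Finset V}
    {f : V ↪ W} (h : ∀ x ∈ S, ∀ y ∈ S, (G.Adj x y ↔ H.Adj (f x) (f y))) {a b : V} (ha : a ∈ S)
    (hb : b ∈ S) : ∀ x ∈ S, ∀ y ∈ S,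
      ((pivot G a b).Adj x y ↔ (pivot H (f a) (f b)).Adj (f x) (f y)) := by
  intro x hx y hy
  simp only [pivot_adj, Distinguished, f.injective.ne_iff, ← h x hx y hy, ← h x hx a ha,
    ← h x hx b hb, ← h y hy a ha, ← h y hy b hb]

theorem pivot_pivot {V : Type u} {G : SimpleGraph V} {a b c : V} (hab : G.Adj a b)
    (hac : G.Adj a c) (hbc : b ≠ c) {x y : V} (hxb : x ≠ b) (hxc : x ≠ c) (hyb : y ≠ b)
    (hyc : y ≠ c) : (pivot (pivot G a b) a c).Adj x y ↔ (pivot G a c).Adj x y := by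
  have h1 := hab.ne
  have h2 := hac.ne
  have h1' := h1.symm
  have h2' := h2.symm
  have h3' := hbc.symm
  have s1 := hab.symm
  have s2 := hac.symm
  have s3 := G.adj_comm b c
  have s4 := G.adj_comm x a
  have s5 := G.adj_comm y a
  simp only [pivot_adj, Distinguished, Xor]
  by_cases xa : x = a
  · subst xa; grind
  by_cases ya : y = a
  · subst ya; grind
  by_cases e1 : G.Adj x a <;> by_cases e2 : G.Adj x b <;> by_cases e3 : G.Adj x c <;>
  by_cases e4 : G.Adj y a <;> by_cases e5 : G.Adj y b <;> by_cases e6 : G.Adj y c <;>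
  by_cases e7 : G.Adj b c <;> by_cases e8 : G.Adj x y <;> simp_all

theorem pivot_pivot_swap {V : Type u} [DecidableEq V] {G : SimpleGraph V} {a b c : V}
    (hab : G.Adj a b) (hac : G.Adj a c) (hbc : b ≠ c) {x y : V} (hxa : x ≠ a) (hxb : x ≠ b)
    (hya : y ≠ a) (hyb : y ≠ b) : (pivot G a b).Adj x y ↔
      (pivot (pivot G a c) a b).Adj (Equiv.swap b c x) (Equiv.swap b c y) := by
  have h1 := hab.ne
  have h2 := hac.ne
  have h1' := h1.symm
  have h2' := h2.symm
  have h3' := hbc.symm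
  have s1 := hab.symm
  have s2 := hac.symm
  have s3 := G.adj_comm b c
  have s4 := G.adj_comm x b
  have s5 := G.adj_comm y b
  have s6 := G.adj_comm x c
  have s7 := G.adj_comm y c
  have i1 := G.irrefl (v := b)
  have i2 := G.irrefl (v := c)
  by_cases xc : x = c
  · by_cases yc : y = c
    · subst xc yc; simp
    rw [xc, Equiv.swap_apply_right, Equiv.swap_apply_of_ne_of_ne hyb yc]
    subst xc
    simp only [pivot_adj, Distinguished, Xor]
    by_cases e1 : G.Adj y a <;> by_cases e2 : G.Adj y b <;> by_cases e3 : G.Adj y x <;>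
    by_cases e4 : G.Adj b x <;> simp_all
  by_cases yc : y = c
  · rw [yc, Equiv.swap_apply_right, Equiv.swap_apply_of_ne_of_ne hxb xc]
    subst yc
    simp only [pivot_adj, Distinguished, Xor]
    by_cases e1 : G.Adj x a <;> by_cases e2 : G.Adj x b <;> by_cases e3 : G.Adj x y <;>
    by_cases e4 : G.Adj b y <;> simp_all
  rw [Equiv.swap_apply_of_ne_of_ne hxb xc, Equiv.swap_apply_of_ne_of_ne hyb yc]
  simp only [pivot_adj, Distinguished, Xor]
  by_cases e1 : G.Adj x a <;> by_cases e2 : G.Adj x b <;> by_cases e3 : G.Adj x c <;>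
  by_cases e4 : G.Adj y a <;> by_cases e5 : G.Adj y b <;> by_cases e6 : G.Adj y c <;>
  by_cases e7 : G.Adj b c <;> by_cases e8 : G.Adj x y <;> simp_all

theorem pivot_pivot_comm {V : Type u} {G : SimpleGraph V} {a b c d : V} (hac : ¬ G.Adj a c)
    (had : ¬ G.Adj a d) (hbc : ¬ G.Adj b c) (hbd : ¬ G.Adj b d) :
    pivot (pivot G a b) c d = pivot (pivot G c d) a b := by
  have key : ∀ (a b c d : V), ¬ G.Adj a c → ¬ G.Adj a d → ¬ G.Adj b c → ¬ G.Adj b d → ∀ x,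
      ((pivot G a b).Adj x c ↔ G.Adj x c) ∧ ((pivot G a b).Adj x d ↔ G.Adj x d) := by
    intro a b c d h1 h2 h3 h4 x
    have := G.adj_comm a c
    have := G.adj_comm a d
    have := G.adj_comm b c
    have := G.adj_comm b d
    simp only [pivot_adj, Distinguished, Xor]
    constructor <;> grind
  have k1 := key a b c d hac had hbc hbd
  have k2 := key c d a b (fun h => hac h.symm) (fun h => hbc h.symm) (fun h => had h.symm)
    (fun h => hbd h.symm)
  ext x y
  rw [pivot_adj (pivot G a b), pivot_adj (pivot G c d)]
  unfold Distinguished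
  rw [(k1 x).1, (k1 x).2, (k1 y).1, (k1 y).2, (k2 x).1, (k2 x).2, (k2 y).1, (k2 y).2,
    pivot_adj, pivot_adj]
  change Xor (Xor _ (Distinguished G a b x y)) (Distinguished G c d x y) ↔
    Xor (Xor _ (Distinguished G c d x y)) (Distinguished G a b x y)
  simp only [Xor]
  tauto

/-- The pivot-reduction identity, for all graphs induced on `n` vertices. -/
def Reduces (n : ℕ) : Prop :=
  ∀ (V : Type u) [DecidableEq V] (G : SimpleGraph V) (S : Finset V), S.card = n →
    ∀ a ∈ S, ∀ b ∈ S, G.Adj a b →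
      interlaceOn G S = interlaceOn G (S.erase a) + interlaceOn (pivot G a b) (S.erase b)

theorem interlaceOn_of_not_adj {V : Type u} {G : SimpleGraph V} {S : Finset V}
    (h : ∀ a ∈ S, ∀ b ∈ S, ¬ G.Adj a b) : interlaceOn G S = X ^ S.card := by
  rw [interlaceOn, dif_neg]
  rintro ⟨e, h1, h2, h3⟩
  exact h _ h1 _ h2 h3

theorem interlaceOn_map {n : ℕ} (hn : ∀ k < n, Reduces.{u} k) :
    ∀ (k : ℕ), k < n → ∀ {V W : Type u} {G : SimpleGraph V} {H : SimpleGraph W} (S : Finset V)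
      (f : V ↪ W), S.card = k → (∀ x ∈ S, ∀ y ∈ S, (G.Adj x y ↔ H.Adj (f x) (f y))) →
      interlaceOn G S = interlaceOn H (S.map f) := by
  classical
  intro k
  induction k with
  | zero =>
    intro _ V W G H S f hS _
    obtain rfl := Finset.card_eq_zero.1 hS
    rw [interlaceOn_of_not_adj (by simp), interlaceOn_of_not_adj (by simp)]
    simp
  | succ k ih =>
    intro hk V W G H S f hS hf
    by_cases h : ∃ a ∈ S, ∃ b ∈ S, G.Adj a b
    · obtain ⟨a, ha, b, hb, hab⟩ := h
      rw [hn _ hk V G S hS a ha b hb hab, hn _ hk W H (S.map f) (by simpa using hS) (f a)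
        (by simpa using ha) (f b) (by simpa using hb) ((hf a ha b hb).1 hab),
        ← Finset.map_erase, ← Finset.map_erase]
      congr 1
      · refine ih (by omega) _ f (by rw [Finset.card_erase_of_mem ha, hS]; rfl) ?_
        intro x hx y hy
        exact hf x (Finset.mem_of_mem_erase hx) y (Finset.mem_of_mem_erase hy)
      · refine ih (by omega) _ f (by rw [Finset.card_erase_of_mem hb, hS]; rfl) ?_
        intro x hx y hy
        exact pivot_congr hf ha hb x (Finset.mem_of_mem_erase hx) y (Finset.mem_of_mem_erase hy)
    · push Not at h
      rw [interlaceOn_of_not_adj h, interlaceOn_of_not_adj, Finset.card_map]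
      intro x' hx' y' hy'
      obtain ⟨x, hx, rfl⟩ := Finset.mem_map.1 hx'
      obtain ⟨y, hy, rfl⟩ := Finset.mem_map.1 hy'
      rw [← hf x hx y hy]
      exact h x hx y hy

theorem reduces (n : ℕ) : Reduces.{u} n := by
  induction n using Nat.strong_induction_on with
  | _ n hn =>
  intro V _ G S hS
  have congr' : ∀ (G H : SimpleGraph V) (T : Finset V), T.card < n →
      (∀ x ∈ T, ∀ y ∈ T, (G.Adj x y ↔ H.Adj x y)) → interlaceOn G T = interlaceOn H T := by
    intro G H T hT h
    have := interlaceOn_map hn _ hT (G := G) (H := H) T (Function.Embedding.refl V) rfl h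
    simpa using this
  have red : ∀ (G : SimpleGraph V) (T : Finset V), T.card < n → ∀ a ∈ T, ∀ b ∈ T, G.Adj a b →
      interlaceOn G T = interlaceOn G (T.erase a) + interlaceOn (pivot G a b) (T.erase b) :=
    fun G T hT => hn _ hT V G T rfl
  have lt1 : ∀ a ∈ S, (S.erase a).card < n := fun a ha => hS ▸ Finset.card_erase_lt_of_mem ha
  have lt2 : ∀ a ∈ S, ∀ b, ((S.erase a).erase b).card < n := fun a ha b =>
    lt_of_le_of_lt (Finset.card_le_card (Finset.erase_subset _ _)) (lt1 a ha)
  let T : V → V → ℤ[X] := fun a b =>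
    interlaceOn G (S.erase a) + interlaceOn (pivot G a b) (S.erase b)
  -- two-step expansion when `a` has a neighbour `c` other than `b`
  have E : ∀ a ∈ S, ∀ b ∈ S, ∀ c ∈ S, G.Adj a b → G.Adj a c → b ≠ c →
      T a b = interlaceOn G (S.erase a) + interlaceOn (pivot G a b) ((S.erase a).erase b) +
        interlaceOn (pivot G a c) ((S.erase b).erase c) := by
    intro a ha b hb c hc hab hac hbc
    have h1 := red (pivot G a b) (S.erase b) (lt1 b hb) a (by simp [ha, hab.ne]) c
      (by simp [hc, hbc.symm]) ((pivot_adj_left G a b c).2 hac)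
    have h2 := congr' (pivot (pivot G a b) a c) (pivot G a c) ((S.erase b).erase c) (lt2 b hb c)
      (fun x hx y hy => by
        simp only [Finset.mem_erase] at hx hy
        exact pivot_pivot hab hac hbc hx.2.1 hx.1 hy.2.1 hy.1)
    simp only [T]
    rw [h1, h2, Finset.erase_right_comm (a := b) (b := a), add_assoc]
  -- symmetric form of the expansion
  have K : ∀ a ∈ S, ∀ b ∈ S, G.Adj a b →
      T a b = interlaceOn G (S.erase a) + interlaceOn G (S.erase b) +
        interlaceOn (pivot G a b) ((S.erase a).erase b) -
        interlaceOn G ((S.erase a).erase b) := by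
    intro a ha b hb hab
    by_cases h : ∃ c ∈ S, G.Adj a c ∧ b ≠ c
    · obtain ⟨c, hc, hac, hbc⟩ := h
      have h1 := red G (S.erase b) (lt1 b hb) a (by simp [ha, hab.ne]) c
        (by simp [hc, hbc.symm]) hac
      rw [E a ha b hb c hc hab hac hbc, h1, Finset.erase_right_comm (a := b) (b := a)]
      ring
    · push Not at h
      have hp : ∀ x ∈ S, ∀ y ∈ S, ((pivot G a b).Adj x y ↔ G.Adj x y) := by
        intro x hx y hy
        have hx' := h x hx
        have hy' := h y hy
        have := G.adj_comm a x
        have := G.adj_comm a y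
        simp only [pivot_adj, Distinguished, Xor]
        grind
      have h1 := congr' (pivot G a b) G (S.erase b) (lt1 b hb) (fun x hx y hy =>
        hp x (Finset.mem_of_mem_erase hx) y (Finset.mem_of_mem_erase hy))
      have h2 := congr' (pivot G a b) G ((S.erase a).erase b) (lt2 a ha b) (fun x hx y hy =>
        hp x (Finset.mem_of_mem_erase (Finset.mem_of_mem_erase hx)) y
          (Finset.mem_of_mem_erase (Finset.mem_of_mem_erase hy)))
      simp only [T]
      rw [h1, h2]
      ring
  have symm : ∀ a ∈ S, ∀ b ∈ S, G.Adj a b → T a b = T b a := by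
    intro a ha b hb hab
    rw [K a ha b hb hab, K b hb a ha hab.symm, pivot_comm G b a,
      Finset.erase_right_comm (a := b) (b := a)]
    ring
  have share : ∀ a ∈ S, ∀ b ∈ S, ∀ c ∈ S, G.Adj a b → G.Adj a c → T a b = T a c := by
    intro a ha b hb c hc hab hac
    by_cases hbc : b = c
    · rw [hbc]
    have h1 := red (pivot G a c) (S.erase c) (lt1 c hc) b (by simp [hb, hbc]) a
      (by simp [ha, hac.ne]) ((pivot_adj_left G a c b).2 hab).symm
    have h2 := interlaceOn_map hn _ (lt2 a ha b) (G := pivot G a b)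
      (H := pivot (pivot G a c) a b) ((S.erase a).erase b) (Equiv.swap b c).toEmbedding rfl
      (fun x hx y hy => by
        simp only [Finset.mem_erase] at hx hy
        exact pivot_pivot_swap hab hac hbc hx.2.1 hx.1 hy.2.1 hy.1)
    have h3 : ((S.erase a).erase b).map (Equiv.swap b c).toEmbedding = (S.erase c).erase a := by
      ext x
      simp only [Finset.mem_map_equiv, Equiv.symm_swap, Finset.mem_erase]
      have := hab.ne
      have := hac.ne
      rcases eq_or_ne x b with rfl | hxb
      · simp only [Equiv.swap_apply_left]; grind
      rcases eq_or_ne x c with rfl | hxc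
      · simp only [Equiv.swap_apply_right]; grind
      rw [Equiv.swap_apply_of_ne_of_ne hxb hxc]; grind
    rw [h3] at h2
    rw [E a ha b hb c hc hab hac hbc, h2]
    simp only [T]
    rw [h1, pivot_comm (pivot G a c) b a, Finset.erase_right_comm (a := c) (b := b)]
    ring
  have all : ∀ a ∈ S, ∀ b ∈ S, ∀ c ∈ S, ∀ d ∈ S, G.Adj a b → G.Adj c d → T a b = T c d := by
    intro a ha b hb c hc d hd hab hcd
    have chain : ∀ a ∈ S, ∀ b ∈ S, ∀ c ∈ S, ∀ d ∈ S, G.Adj a b → G.Adj c d → G.Adj a c →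
        T a b = T c d := fun a ha b hb c hc d hd hab hcd hac =>
      (share a ha b hb c hc hab hac).trans
        ((symm a ha c hc hac).trans (share c hc a ha d hd hac.symm hcd))
    by_cases hac : G.Adj a c
    · exact chain a ha b hb c hc d hd hab hcd hac
    by_cases hbc : G.Adj b c
    · rw [symm a ha b hb hab]; exact chain b hb a ha c hc d hd hab.symm hcd hbc
    by_cases had : G.Adj a d
    · rw [symm c hc d hd hcd]; exact chain a ha b hb d hd c hc hab hcd.symm had
    by_cases hbd : G.Adj b d
    · rw [symm a ha b hb hab, symm c hc d hd hcd]
      exact chain b hb a ha d hd c hc hab.symm hcd.symm hbd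
    have nac : a ≠ c := by rintro rfl; exact hbc hab.symm
    have nad : a ≠ d := by rintro rfl; exact hbd hab.symm
    have nbc : b ≠ c := by rintro rfl; exact hac hab
    have nbd : b ≠ d := by rintro rfl; exact had hab
    have keep : ∀ (a b c d : V), ¬ G.Adj a c → ¬ G.Adj b c → G.Adj c d →
        (pivot G a b).Adj c d := by
      intro a b c d h1 h2 h3
      have := G.adj_comm a c
      have := G.adj_comm b c
      simp only [pivot_adj, Distinguished, Xor]
      grind
    simp only [T]
    rw [red G (S.erase a) (lt1 a ha) c (by simp [hc, nac.symm]) d (by simp [hd, nad.symm]) hcd,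
      red (pivot G a b) (S.erase b) (lt1 b hb) c (by simp [hc, nbc.symm]) d
        (by simp [hd, nbd.symm]) (keep a b c d hac hbc hcd),
      red G (S.erase c) (lt1 c hc) a (by simp [ha, nac]) b (by simp [hb, nbc]) hab,
      red (pivot G c d) (S.erase d) (lt1 d hd) a (by simp [ha, nad]) b
        (by simp [hb, nbd]) (keep c d a b (fun h => hac h.symm) (fun h => had h.symm) hab),
      pivot_pivot_comm hac had hbc hbd, Finset.erase_right_comm (a := c) (b := a),
      Finset.erase_right_comm (a := c) (b := b), Finset.erase_right_comm (a := d) (b := a),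
      Finset.erase_right_comm (a := d) (b := b)]
    ring
  intro a ha b hb hab
  have hex : ∃ e : V × V, e.1 ∈ S ∧ e.2 ∈ S ∧ G.Adj e.1 e.2 := ⟨(a, b), ha, hb, hab⟩
  have hs := hex.choose_spec
  have h0 : interlaceOn G S = T hex.choose.1 hex.choose.2 := by
    rw [interlaceOn, dif_pos hex]
    simp only [T]
    congr! 3
  rw [h0]
  exact all _ hs.1 _ hs.2.1 a ha b hb hs.2.2 hab

/-- The pivot-reduction identity holds at every edge. -/
theorem interlaceOn_of_adj {V : Type u} [DecidableEq V] (G : SimpleGraph V) (S : Finset V)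
    {a b : V} (ha : a ∈ S) (hb : b ∈ S) (hab : G.Adj a b) :
    interlaceOn G S = interlaceOn G (S.erase a) + interlaceOn (pivot G a b) (S.erase b) :=
  reduces _ V G S rfl a ha b hb hab

/-- `interlaceOn G S` is the interlace polynomial of the induced subgraph `G[S]`. -/
theorem interlacePolynomial_induce {V : Type u} [Fintype V] (G : SimpleGraph V) (s : Set V)
    [Fintype s] : interlacePolynomial (G.induce s) = interlaceOn G s.toFinset := by
  rw [interlacePolynomial, interlaceOn_map (n := (Finset.univ : Finset s).card + 1)
    (fun k _ => reduces k) _ (Nat.lt_succ_self _) (H := G) Finset.univ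
    (Function.Embedding.subtype _) rfl (fun x _ y _ => Iff.rfl)]
  congr 1

/-- On the edgeless graph with `n` vertices, `q(E_n) = X ^ n`. -/
theorem interlacePolynomial_bot {V : Type u} [Fintype V] :
    interlacePolynomial (⊥ : SimpleGraph V) = X ^ Fintype.card V :=
  interlaceOn_of_not_adj (fun _ _ _ _ h => h)

/-- If `ab` is an edge of `G` then `q(G) = q(G - a) + q(G^{ab} - b)`. -/
theorem interlacePolynomial_of_adj {V : Type u} [Fintype V] [DecidableEq V] (G : SimpleGraph V)
    {a b : V} (hab : G.Adj a b) : interlacePolynomial G =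
      interlacePolynomial (G.induce {x | x ≠ a}) +
        interlacePolynomial ((pivot G a b).induce {x | x ≠ b}) := by
  rw [interlacePolynomial_induce, interlacePolynomial_induce, interlacePolynomial,
    interlaceOn_of_adj G _ (Finset.mem_univ a) (Finset.mem_univ b) hab]
  congr 2 <;> (ext x; simp)

/-- The two properties above determine the interlace polynomial. -/
theorem interlacePolynomial_unique
    (q : ∀ (V : Type u) [Fintype V], SimpleGraph V → ℤ[X])
    (h0 : ∀ (V : Type u) [Fintype V], q V ⊥ = X ^ Fintype.card V)
    (h1 : ∀ (V : Type u) [Fintype V] [DecidableEq V] (G : SimpleGraph V) (a b : V), G.Adj a b →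
      q V G = q {x | x ≠ a} (G.induce {x | x ≠ a}) +
        q {x | x ≠ b} ((pivot G a b).induce {x | x ≠ b})) :
    ∀ (V : Type u) [Fintype V] (G : SimpleGraph V), q V G = interlacePolynomial G := by
  classical
  suffices h : ∀ (n : ℕ) (V : Type u) [Fintype V] (G : SimpleGraph V), Fintype.card V = n →
      q V G = interlacePolynomial G from fun V _ G => h _ V G rfl
  intro n
  induction n with
  | zero =>
    intro V _ G hV
    have := Fintype.card_eq_zero_iff.1 hV
    obtain rfl : G = ⊥ := Subsingleton.elim _ _
    rw [h0, interlacePolynomial_bot]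
  | succ n ih =>
    intro V _ G hV
    by_cases h : ∃ a b, G.Adj a b
    · obtain ⟨a, b, hab⟩ := h
      rw [h1 V G a b hab, interlacePolynomial_of_adj G hab, ih, ih] <;>
        simp [Set.coe_ofPred, Fintype.card_subtype_compl, hV]
    · push Not at h
      obtain rfl : G = ⊥ := by
        ext a b
        simpa using h a b
      rw [h0, interlacePolynomial_bot]

end InterlacePoly

/-!
The value `q_G(1)` is the number `N(G)` of vertex sets `T` for which the principal submatrix `A[T]`
of the adjacency matrix over `𝔽₂` is nonsingular (`eval_one_interlaceOn`). Indeed `N` satisfies the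
recursion of the interlace polynomial: the sets avoiding `a` are those of `G - a`, and the sets
containing `a` correspond to the nonsingular sets of `G^{ab} - b`, because the adjacency matrix of
`G^{ab}` is, up to exchanging the labels `a` and `b`, the principal pivot transform of `A` on the
block `{a, b}` (`adjSum_pivot`, `nonsing_pivotSet`).

All bounds come from one inequality, `numNonsing_le_of_erase`: for every vertex `v`,
`N(G) ≤ N(G - v) + ∑ N(G - v - u)`, the sum being over the neighbours `u` of `v`. It holds because
the Pfaffian of a nonsingular `A[T]` has a nonzero term in its expansion along the row of `v`. At a
leaf it is an equality (`le_numNonsing_of_leaf`).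

For a connected graph with `m` edges, `N(G) ≤ F_{m+2}` is proved together with
`N(G - u) ≤ F_{m+1}` for every vertex `u`, the latter being strict when `u` has degree at least two
(`Conn.numNonsing_le`). For the first bound one expands at a vertex whose deletion leaves the graph
connected. For the second, either `G - u` is connected, or `G` is the union of two smaller connected
graphs meeting in `u`, and then `F_{k+1} F_{l+1} ≤ F_{k+l+1}` applies. Equality in the first bound
forces the expanded vertex to be a leaf attached to an end of a smaller extremal graph, so that the
extremal graphs are the paths (`Conn.exists_isPathOn`).

The bound for components follows since `N` is submultiplicative over disjoint unions
(`numNonsing_union_le`). Finally, the expansion at a vertex of degree `d` together with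
`d + 1 ≤ 2 ^ d` gives `N(G) ≤ 2 ^ m`, and equality forces `d + 1 = 2 ^ d`, that is `d ≤ 1`, for
every vertex (`numNonsing_le_two_pow`, `card_nbrs_le_one`).
-/

namespace InterlacePoly

/-! ### Nonsingular vertex sets -/

open Classical in
/-- The value at `v` of the product of the adjacency matrix of `G` over `𝔽₂` with the vector `x`. -/
noncomputable def adjSum {V : Type u} [Fintype V] (G : SimpleGraph V) (x : V → ZMod 2) (v : V) :
    ZMod 2 :=
  ∑ w, if G.Adj v w then x w else 0

/-- The principal submatrix of the adjacency matrix of `G` over `𝔽₂` with rows and columns in `T`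
is nonsingular. This is expressed by the triviality of its kernel, whose elements are extended by
zero to vectors indexed by all vertices. -/
def Nonsing {V : Type u} [Fintype V] (G : SimpleGraph V) (T : Finset V) : Prop :=
  ∀ x : V → ZMod 2, (∀ v ∉ T, x v = 0) → (∀ v ∈ T, adjSum G x v = 0) → x = 0

open Classical in
/-- The number of subsets of `S` that are nonsingular for `G`; it equals the value at `1` of the
interlace polynomial of `G[S]` (`eval_one_interlaceOn`). -/
noncomputable def numNonsing {V : Type u} [Fintype V] (G : SimpleGraph V) (S : Finset V) : ℕ :=
  (S.powerset.filter (Nonsing G)).card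

open Classical in
/-- The neighbours of `v` in the vertex set `S`. -/
noncomputable def nbrs {V : Type u} (G : SimpleGraph V) (S : Finset V) (v : V) : Finset V :=
  S.filter (G.Adj v)

theorem mem_nbrs {V : Type u} {G : SimpleGraph V} {S : Finset V} {v w : V} :
    w ∈ nbrs G S v ↔ w ∈ S ∧ G.Adj v w := by simp [nbrs]

section Nonsingular

variable {V : Type u} [Fintype V] {G : SimpleGraph V} {S T : Finset V}

theorem nonsing_empty : Nonsing G ∅ := fun x hx _ => funext fun v => hx v (by simp)

theorem adjSum_eq_zero {x : V → ZMod 2} {v : V} (h : ∀ w, G.Adj v w → x w = 0) :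
    adjSum G x v = 0 := by
  classical
  refine Finset.sum_eq_zero fun w _ => ?_
  split_ifs with hw
  · exact h w hw
  · rfl

theorem adjSum_eq_of_unique {x : V → ZMod 2} {v u : V} (huv : G.Adj v u)
    (h : ∀ w, G.Adj v w → w ≠ u → x w = 0) : adjSum G x v = x u := by
  classical
  unfold adjSum
  rw [Finset.sum_eq_single u]
  · simp [huv]
  · intro w _ hw
    split_ifs with h1
    · exact h w h1 hw
    · rfl
  · simp

theorem not_nonsing_of_edgeless (hT : T.Nonempty) (h : ∀ a ∈ T, ∀ b ∈ T, ¬ G.Adj a b) :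
    ¬ Nonsing G T := by
  classical
  obtain ⟨t, ht⟩ := hT
  intro hn
  have := hn (Pi.single t 1) (fun v hv => by
    rw [Pi.single_eq_of_ne]; rintro rfl; exact hv ht) (fun v hv => adjSum_eq_zero fun w hw => by
    rw [Pi.single_eq_of_ne]; rintro rfl; exact h _ hv _ ht hw)
  have := congrFun this t
  simp at this

/-- The bilinear form of the adjacency matrix is symmetric. -/
theorem sum_mul_adjSum_comm (x y : V → ZMod 2) :
    ∑ v, x v * adjSum G y v = ∑ v, y v * adjSum G x v := by
  classical
  simp only [adjSum, Finset.mul_sum]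
  rw [Finset.sum_comm]
  refine Finset.sum_congr rfl fun v _ => Finset.sum_congr rfl fun w _ => ?_
  rw [G.adj_comm]
  split_ifs <;> ring

/-- The bilinear form of the adjacency matrix is alternating. -/
theorem sum_mul_adjSum_self (x : V → ZMod 2) : ∑ v, x v * adjSum G x v = 0 := by
  classical
  simp only [adjSum, Finset.mul_sum]
  rw [← Finset.sum_product']
  refine Finset.sum_involution (fun p _ => p.swap) ?_ ?_ (by simp) (by simp)
  · intro p _
    have : G.Adj p.1 p.2 ↔ G.Adj p.2 p.1 := G.adj_comm _ _
    simp only [Prod.fst_swap, Prod.snd_swap, this]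
    split_ifs
    · rw [mul_comm (x p.2)]; exact CharTwo.add_self_eq_zero _
    · simp
  · rintro ⟨v, w⟩ _ h h2
    simp only [Prod.swap_prod_mk, Prod.mk.injEq] at h2
    simp [h2.1] at h

/-- The expansion of a nonzero Pfaffian along the row of `v` has a nonzero term. -/
theorem Nonsing.exists_erase_erase [DecidableEq V] (hT : Nonsing G T) {v : V} (hv : v ∈ T) :
    ∃ u ∈ T, G.Adj v u ∧ Nonsing G ((T.erase v).erase u) := by
  classical
  let f : (V → ZMod 2) →ₗ[ZMod 2] (V → ZMod 2) :=
    { toFun := fun x w => if w ∈ T then adjSum G x w else x w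
      map_add' := by
        intro x y
        funext w
        simp only [Pi.add_apply]
        split_ifs
        · simp only [adjSum, ← Finset.sum_add_distrib]
          refine Finset.sum_congr rfl fun i _ => ?_
          split_ifs <;> simp
        · rfl
      map_smul' := by
        intro c x
        funext w
        simp only [Pi.smul_apply, RingHom.id_apply, smul_eq_mul]
        split_ifs
        · simp only [adjSum, Finset.mul_sum]
          refine Finset.sum_congr rfl fun i _ => ?_
          split_ifs <;> simp
        · rfl }
  have hf : ∀ x w, f x w = if w ∈ T then adjSum G x w else x w := fun _ _ => rfl
  have hinj : Function.Injective f := by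
    rw [injective_iff_map_eq_zero]
    intro x hx
    refine hT x (fun w hw => ?_) (fun w hw => ?_)
    · have := congrFun hx w; rwa [hf, if_neg hw] at this
    · have := congrFun hx w; rwa [hf, if_pos hw] at this
  -- `b` is the column of `v` in the inverse matrix
  obtain ⟨b, hb⟩ := (LinearMap.injective_iff_surjective.1 hinj) (Pi.single v 1)
  have hb0 : ∀ w ∉ T, b w = 0 := fun w hw => by
    have := congrFun hb w
    rw [hf, if_neg hw, Pi.single_eq_of_ne (by rintro rfl; exact hw hv)] at this
    exact this
  have hb1 : adjSum G b v = 1 := by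
    have := congrFun hb v
    rwa [hf, if_pos hv, Pi.single_eq_same] at this
  have hb2 : ∀ w ∈ T, w ≠ v → adjSum G b w = 0 := fun w hw hwv => by
    have := congrFun hb w
    rwa [hf, if_pos hw, Pi.single_eq_of_ne hwv] at this
  have hbv : b v = 0 := by
    have := sum_mul_adjSum_self (G := G) b
    rw [Finset.sum_eq_single v, hb1, mul_one] at this
    · exact this
    · intro w _ hw
      by_cases hwT : w ∈ T
      · rw [hb2 w hwT hw, mul_zero]
      · rw [hb0 w hwT, zero_mul]
    · simp
  obtain ⟨u, huv, hbu⟩ : ∃ u, G.Adj v u ∧ b u ≠ 0 := by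
    by_contra! h
    rw [adjSum_eq_zero h] at hb1
    exact zero_ne_one hb1
  have hbu1 : b u = 1 := by
    have : ∀ z : ZMod 2, z ≠ 0 → z = 1 := by decide
    exact this _ hbu
  have huT : u ∈ T := by
    by_contra h
    exact hbu (hb0 u h)
  refine ⟨u, huT, huv, fun x hx0 hx1 => ?_⟩
  have hxT : ∀ w ∉ T, x w = 0 := fun w hw => hx0 w fun h =>
    hw (Finset.mem_of_mem_erase (Finset.mem_of_mem_erase h))
  have hxu : x u = 0 := hx0 u (by simp)
  have hxv : x v = 0 := hx0 v (by simp)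
  have hzero : ∀ w ∈ T, w ≠ v → w ≠ u → adjSum G x w = 0 := fun w hw h1 h2 =>
    hx1 w (by simp [hw, h1, h2])
  -- pairing `x` with `b` in both ways
  have hαu : adjSum G x u = 0 := by
    have h1 := sum_mul_adjSum_comm (G := G) b x
    rw [Finset.sum_eq_single u, Finset.sum_eq_zero, hbu1, one_mul] at h1
    · exact h1
    · intro w _
      by_cases hwT : w ∈ T
      · by_cases hwv : w = v
        · rw [hwv, hxv, zero_mul]
        · rw [hb2 w hwT hwv, mul_zero]
      · rw [hxT w hwT, zero_mul]
    · intro w _ hwu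
      by_cases hwT : w ∈ T
      · by_cases hwv : w = v
        · rw [hwv, hbv, zero_mul]
        · rw [hzero w hwT hwv hwu, mul_zero]
      · rw [hb0 w hwT, zero_mul]
    · simp
  have hx : x = adjSum G x v • b := by
    apply hinj
    rw [map_smul, hb]
    funext w
    rw [hf]
    by_cases hwv : w = v
    · subst hwv; simp [hv]
    · simp only [Pi.smul_apply, Pi.single_eq_of_ne hwv, smul_zero]
      split_ifs with hwT
      · by_cases hwu : w = u
        · rw [hwu, hαu]
        · exact hzero w hwT hwv hwu
      · exact hxT w hwT
  have hβ : adjSum G x v = 0 := by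
    have := congrFun hx u
    rw [hxu, Pi.smul_apply, hbu1, smul_eq_mul, mul_one] at this
    exact this.symm
  rw [hx, hβ, zero_smul]

theorem numNonsing_pos : 0 < numNonsing G S :=
  Finset.card_pos.2 ⟨∅, by simp [nonsing_empty]⟩

theorem numNonsing_le_of_erase [DecidableEq V] {v : V} : numNonsing G S ≤
    numNonsing G (S.erase v) + ∑ u ∈ nbrs G S v, numNonsing G ((S.erase v).erase u) := by
  classical
  have hsub : S.powerset.filter (Nonsing G) ⊆ (S.erase v).powerset.filter (Nonsing G) ∪
      (nbrs G S v).biUnion fun u => (((S.erase v).erase u).powerset.filter (Nonsing G)).image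
        fun T => insert v (insert u T) := by
    intro T hT
    simp only [Finset.mem_filter, Finset.mem_powerset] at hT
    by_cases hvT : v ∈ T
    · obtain ⟨u, hu, huv, hn⟩ := hT.2.exists_erase_erase hvT
      simp only [Finset.mem_union, Finset.mem_biUnion, Finset.mem_image, Finset.mem_filter,
        Finset.mem_powerset]
      refine Or.inr ⟨u, mem_nbrs.2 ⟨hT.1 hu, huv⟩, (T.erase v).erase u, ⟨?_, hn⟩, ?_⟩
      · exact Finset.erase_subset_erase _ (Finset.erase_subset_erase _ hT.1)
      · have := huv.ne
        ext w
        simp only [Finset.mem_insert, Finset.mem_erase]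
        grind
    · simp only [Finset.mem_union, Finset.mem_filter, Finset.mem_powerset]
      exact Or.inl ⟨Finset.subset_erase.2 ⟨hT.1, hvT⟩, hT.2⟩
  refine (Finset.card_le_card hsub).trans ((Finset.card_union_le _ _).trans ?_)
  refine Nat.add_le_add le_rfl (Finset.card_biUnion_le.trans ?_)
  exact Finset.sum_le_sum fun u _ => Finset.card_image_le

/-- At a vertex `v` whose only neighbour in `S` is `u`, the bound of `numNonsing_le_of_erase` is
attained. -/
theorem le_numNonsing_of_leaf [DecidableEq V] {v u : V} (hv : v ∈ S) (hu : u ∈ S)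
    (huv : G.Adj v u) (h : ∀ w ∈ S, G.Adj v w → w = u) :
    numNonsing G (S.erase v) + numNonsing G ((S.erase v).erase u) ≤ numNonsing G S := by
  classical
  have hne := huv.ne
  have hext : ∀ T ⊆ (S.erase v).erase u, Nonsing G T → Nonsing G (insert v (insert u T)) := by
    intro T hTS hT x hx0 hx1
    have hxu : x u = 0 := by
      rw [← hx1 v (by simp), adjSum_eq_of_unique huv]
      intro w hw hwu
      by_contra hxw
      have hwT : w ∈ insert v (insert u T) := by
        by_contra hc; exact hxw (hx0 w hc)
      refine hwu (h w ?_ hw)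
      have := @hTS w
      simp only [Finset.mem_insert, Finset.mem_erase] at *
      grind
    have hTnv : ∀ w ∈ T, ¬ G.Adj w v := fun w hw hwv => by
      have := hTS hw
      simp only [Finset.mem_erase] at this
      exact this.1 (h w this.2.2 hwv.symm)
    have hvT : v ∉ T := fun hvT => by simpa using hTS hvT
    have huT : u ∉ T := fun huT => by simpa using hTS huT
    have hy : Function.update x v 0 = 0 := by
      refine hT _ (fun w hw => ?_) (fun w hw => ?_)
      · by_cases hwv : w = v
        · simp [hwv]
        · rw [Function.update_of_ne hwv]
          by_cases hwu : w = u
          · rw [hwu, hxu]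
          · exact hx0 w (by simp [hwv, hwu, hw])
      · rw [← hx1 w (by simp [hw])]
        refine Finset.sum_congr rfl fun z _ => ?_
        by_cases hzv : z = v
        · rw [hzv, if_neg (hTnv w hw), if_neg (hTnv w hw)]
        · rw [Function.update_of_ne hzv]
    have hxw : ∀ w, w ≠ v → x w = 0 := fun w hw => by
      have := congrFun hy w
      rwa [Function.update_of_ne hw] at this
    have hxv : x v = 0 := by
      rw [← hx1 u (by simp), adjSum_eq_of_unique huv.symm fun w _ hw => hxw w hw]
    funext w
    by_cases hw : w = v
    · rw [hw, hxv]; rfl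
    · exact hxw w hw
  have hinj : Set.InjOn (fun T => insert v (insert u T))
      ((((S.erase v).erase u).powerset.filter (Nonsing G) : Finset (Finset V)) :
        Set (Finset V)) := by
    intro T1 h1 T2 h2 h12
    simp only [Finset.coe_filter, Finset.mem_powerset, Set.mem_ofPred_eq] at h1 h2
    ext w
    have h3 := congrArg (w ∈ ·) h12
    have := @h1.1 w
    have := @h2.1 w
    simp only [Finset.mem_insert, Finset.mem_erase] at *
    grind
  rw [numNonsing, numNonsing, numNonsing, ← Finset.card_image_of_injOn hinj,
    ← Finset.card_union_of_disjoint]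
  · refine Finset.card_le_card fun T hT => ?_
    simp only [Finset.mem_union, Finset.mem_image, Finset.mem_filter, Finset.mem_powerset] at *
    rcases hT with ⟨h1, h2⟩ | ⟨T', ⟨h1, h2⟩, rfl⟩
    · exact ⟨h1.trans (Finset.erase_subset _ _), h2⟩
    · refine ⟨?_, hext T' h1 h2⟩
      refine Finset.insert_subset hv (Finset.insert_subset hu (h1.trans ?_))
      exact (Finset.erase_subset _ _).trans (Finset.erase_subset _ _)
  · rw [Finset.disjoint_left]
    intro T h1 h2
    simp only [Finset.mem_image, Finset.mem_filter, Finset.mem_powerset] at h1 h2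
    obtain ⟨T', -, rfl⟩ := h2
    simpa using h1.1 (Finset.mem_insert_self v _)

/-- Nonsingularity of `T` passes to its parts in `A` and `B`, since the submatrix is a block
sum. -/
theorem numNonsing_union_le [DecidableEq V] {A B : Finset V}
    (h : ∀ a ∈ A, ∀ b ∈ B, ¬ G.Adj a b) :
    numNonsing G (A ∪ B) ≤ numNonsing G A * numNonsing G B := by
  classical
  have key : ∀ T C : Finset V, (∀ v ∈ T, v ∉ C → ∀ w ∈ C, ¬ G.Adj v w) → Nonsing G T →
      Nonsing G (T ∩ C) := by
    intro T C hC hT x hx0 hx1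
    refine hT x (fun v hv => hx0 v fun h => hv (Finset.mem_inter.1 h).1) (fun v hv => ?_)
    by_cases hvC : v ∈ C
    · exact hx1 v (Finset.mem_inter.2 ⟨hv, hvC⟩)
    · refine adjSum_eq_zero fun w hw => hx0 w fun hw' => ?_
      exact hC v hv hvC w (Finset.mem_inter.1 hw').2 hw
  rw [numNonsing, numNonsing, numNonsing, ← Finset.card_product]
  refine Finset.card_le_card_of_injOn (fun T => (T ∩ A, T ∩ B)) ?_ ?_
  · intro T hT
    simp only [Finset.coe_filter, Finset.mem_powerset, Set.mem_ofPred_eq] at hT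
    simp only [Finset.coe_product, Set.mem_prod, Finset.mem_coe, Finset.mem_filter,
      Finset.mem_powerset]
    refine ⟨⟨Finset.inter_subset_right, key T A ?_ hT.2⟩,
      ⟨Finset.inter_subset_right, key T B ?_ hT.2⟩⟩
    · intro v hv hvA w hw hvw
      exact h w hw v ((Finset.mem_union.1 (hT.1 hv)).resolve_left hvA) hvw.symm
    · intro v hv hvB w hw hvw
      exact h v ((Finset.mem_union.1 (hT.1 hv)).resolve_right hvB) w hw hvw
  · intro T1 h1 T2 h2 h12
    simp only [Finset.coe_filter, Finset.mem_powerset, Set.mem_ofPred_eq] at h1 h2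
    simp only [Prod.mk.injEq] at h12
    rw [← Finset.inter_eq_left.2 h1.1, ← Finset.inter_eq_left.2 h2.1,
      Finset.inter_union_distrib_left, Finset.inter_union_distrib_left, h12.1, h12.2]

/-! ### The value of the interlace polynomial at `1` -/

open Classical in
/-- Pivoting changes the adjacency matrix away from `a` and `b` as the Schur complement of the
block of `{a, b}` does. -/
theorem pivot_adj_indicator {V : Type u} {G : SimpleGraph V} {a b v w : V}
    (hva : v ≠ a) (hvb : v ≠ b) (hwa : w ≠ a) (hwb : w ≠ b) : ((if (pivot G a b).Adj v w then 1 else 0 : ZMod 2)) =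
      (if G.Adj v w then 1 else 0) + (if G.Adj v a then 1 else 0) * (if G.Adj b w then 1 else 0) +
        (if G.Adj v b then 1 else 0) * (if G.Adj a w then 1 else 0) := by
  have h1 := G.adj_comm b w
  have h2 := G.adj_comm a w
  have h11 : (1 + 1 : ZMod 2) = 0 := rfl
  simp only [pivot_adj, Distinguished, Xor, h1, h2]
  by_cases e1 : G.Adj v w <;> by_cases e2 : G.Adj v a <;> by_cases e3 : G.Adj v b <;>
  by_cases e4 : G.Adj w a <;> by_cases e5 : G.Adj w b <;> simp_all

theorem pivot_pivot_self {V : Type u} {G : SimpleGraph V} {a b : V} : pivot (pivot G a b) a b = G := by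
  ext x y
  simp only [pivot_adj, Distinguished, Xor]
  grind

/-- The symmetric difference of `T ∋ a` with `{a, b}` after the exchange of the labels `a` and `b`.
This is a bijection from the vertex sets that contain `a` to those that avoid `b`, and it takes the
nonsingular sets of `G` to those of `G^{ab}` (`nonsing_pivotSet`). -/
def pivotSet [DecidableEq V] (a b : V) (T : Finset V) : Finset V :=
  if b ∈ T then (T.erase a).erase b else T

theorem adjSum_split [DecidableEq V] {a b : V} (hab : a ≠ b) (x : V → ZMod 2) (v : V) :
    open Classical in
    adjSum G x v = (if G.Adj v a then 1 else 0) * x a + (if G.Adj v b then 1 else 0) * x b +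
      ∑ w ∈ (Finset.univ.erase a).erase b, (if G.Adj v w then 1 else 0) * x w := by
  classical
  unfold adjSum
  rw [← Finset.add_sum_erase _ _ (Finset.mem_univ a),
    ← Finset.add_sum_erase _ _ (show b ∈ Finset.univ.erase a by simp [hab.symm]), add_assoc]
  simp

/-- The principal pivot transform on the block `{a, b}`, followed by the exchange of the labels `a`
and `b`, turns the adjacency matrix of `G` into that of `G^{ab}`: if `y` is the image of `x` under
the first matrix, then exchanging `(x a, x b)` with `(y b, y a)` gives a vector and its image under
the second. -/
theorem adjSum_pivot [DecidableEq V] {a b : V} (hab : G.Adj a b) (x : V → ZMod 2) (v : V) :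
    adjSum (pivot G a b) (Function.update (Function.update x a (adjSum G x b)) b (adjSum G x a)) v =
      if v = a then x b else if v = b then x a else adjSum G x v := by
  classical
  have hne := hab.ne
  have hL : ∀ w, (pivot G a b).Adj a w ↔ G.Adj a w := pivot_adj_left G a b
  have hR : ∀ w, (pivot G a b).Adj b w ↔ G.Adj b w := by
    rw [pivot_comm]; exact pivot_adj_left G b a
  have hL' : ∀ w, (pivot G a b).Adj w a ↔ G.Adj w a := fun w => by
    rw [SimpleGraph.adj_comm, hL, SimpleGraph.adj_comm]
  have hR' : ∀ w, (pivot G a b).Adj w b ↔ G.Adj w b := fun w => by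
    rw [SimpleGraph.adj_comm, hR, SimpleGraph.adj_comm]
  have hcc : ∀ z : ZMod 2, z + z = 0 := fun z => CharTwo.add_self_eq_zero z
  have hsum : ∀ (H : SimpleGraph V) (y : V → ZMod 2) (p q : ZMod 2) (v : V),
      ∑ w ∈ (Finset.univ.erase a).erase b, (if H.Adj v w then 1 else 0 : ZMod 2) *
        Function.update (Function.update y a p) b q w =
      ∑ w ∈ (Finset.univ.erase a).erase b, (if H.Adj v w then 1 else 0 : ZMod 2) * y w := by
    intro H y p q v
    refine Finset.sum_congr rfl fun w hw => ?_
    simp only [Finset.mem_erase] at hw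
    rw [Function.update_of_ne hw.1, Function.update_of_ne hw.2.1]
  have ha := adjSum_split (G := G) hne x a
  have hb := adjSum_split (G := G) hne x b
  simp only [SimpleGraph.irrefl, hab, hab.symm, if_true, if_false, zero_mul, one_mul, zero_add,
    add_zero] at ha hb
  rw [adjSum_split hne, hsum, Function.update_self, Function.update_of_ne hne,
    Function.update_self]
  by_cases hva : v = a
  · subst hva
    simp only [hL, SimpleGraph.irrefl, hab, if_true, if_false, ha]
    linear_combination hcc (∑ w ∈ (Finset.univ.erase v).erase b,
      (if G.Adj v w then 1 else 0 : ZMod 2) * x w)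
  by_cases hvb : v = b
  · subst hvb
    simp only [hR, SimpleGraph.irrefl, hab.symm, hva, if_true, if_false, hb]
    linear_combination hcc (∑ w ∈ (Finset.univ.erase a).erase v,
      (if G.Adj v w then 1 else 0 : ZMod 2) * x w)
  rw [if_neg hva, if_neg hvb]
  have hs : ∑ w ∈ (Finset.univ.erase a).erase b,
        (if (pivot G a b).Adj v w then 1 else 0 : ZMod 2) * x w =
      ∑ w ∈ (Finset.univ.erase a).erase b, (if G.Adj v w then 1 else 0 : ZMod 2) * x w +
      (if G.Adj v a then 1 else 0) * ∑ w ∈ (Finset.univ.erase a).erase b,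
        (if G.Adj b w then 1 else 0 : ZMod 2) * x w +
      (if G.Adj v b then 1 else 0) * ∑ w ∈ (Finset.univ.erase a).erase b,
        (if G.Adj a w then 1 else 0 : ZMod 2) * x w := by
    rw [Finset.mul_sum, Finset.mul_sum, ← Finset.sum_add_distrib, ← Finset.sum_add_distrib]
    refine Finset.sum_congr rfl fun w hw => ?_
    simp only [Finset.mem_erase] at hw
    rw [pivot_adj_indicator hva hvb hw.2.1 hw.1]
    ring
  rw [hs, adjSum_split hne x v, ha, hb]
  simp only [hL', hR']
  linear_combination hcc ((if G.Adj v a then 1 else 0 : ZMod 2) *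
      ∑ w ∈ (Finset.univ.erase a).erase b, (if G.Adj b w then 1 else 0 : ZMod 2) * x w) +
    hcc ((if G.Adj v b then 1 else 0 : ZMod 2) *
      ∑ w ∈ (Finset.univ.erase a).erase b, (if G.Adj a w then 1 else 0 : ZMod 2) * x w)

theorem eq_zero_of_update_adjSum_eq_zero [DecidableEq V] {a b : V} (hab : G.Adj a b)
    {x : V → ZMod 2}
    (h : Function.update (Function.update x a (adjSum G x b)) b (adjSum G x a) = 0) : x = 0 := by
  have key := adjSum_pivot hab x
  rw [h] at key
  have h0 : ∀ v, adjSum (pivot G a b) 0 v = 0 := fun v => adjSum_eq_zero fun _ _ => rfl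
  have hxb := key a
  have hxa := key b
  rw [h0, if_pos rfl] at hxb
  rw [h0, if_neg hab.ne.symm, if_pos rfl] at hxa
  funext v
  by_cases hva : v = a
  · rw [hva, ← hxa]; rfl
  by_cases hvb : v = b
  · rw [hvb, ← hxb]; rfl
  have := congrFun h v
  rwa [Function.update_of_ne hvb, Function.update_of_ne hva] at this

/-- A set `T ∋ a` is nonsingular for `G` precisely when the corresponding set is nonsingular for
`G^{ab}`. -/
theorem nonsing_pivotSet [DecidableEq V] {a b : V} (hab : G.Adj a b) (haT : a ∈ T) :
    Nonsing (pivot G a b) (pivotSet a b T) ↔ Nonsing G T := by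
  have hne := hab.ne
  have hab' : (pivot G a b).Adj a b := (pivot_adj_left G a b b).2 hab
  constructor
  · intro h x hx0 hx1
    refine eq_zero_of_update_adjSum_eq_zero hab (h _ (fun v hv => ?_) (fun v hv => ?_))
    · by_cases hvb : v = b
      · rw [hvb, Function.update_self]
        exact hx1 a haT
      rw [Function.update_of_ne hvb]
      unfold pivotSet at hv
      by_cases hva : v = a
      · rw [hva, Function.update_self]
        refine hx1 b ?_
        by_contra hb
        rw [if_neg hb, hva] at hv
        exact hv haT
      · rw [Function.update_of_ne hva]
        refine hx0 v ?_
        split_ifs at hv with hb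
        · simpa [hva, hvb] using hv
        · exact hv
    · rw [adjSum_pivot hab]
      unfold pivotSet at hv
      by_cases hb : b ∈ T
      · simp only [if_pos hb, Finset.mem_erase] at hv
        rw [if_neg hv.2.1, if_neg hv.1]
        exact hx1 v hv.2.2
      · rw [if_neg hb] at hv
        split_ifs with h1 h2
        · exact hx0 b hb
        · rw [h2] at hv; exact absurd hv hb
        · exact hx1 v hv
  · intro h x hx0 hx1
    have key := adjSum_pivot hab' x
    rw [pivot_pivot_self] at key
    unfold pivotSet at hx0 hx1
    refine eq_zero_of_update_adjSum_eq_zero hab' ?_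
    refine h _ (fun v hv => ?_) (fun v hv => ?_)
    · have hva : v ≠ a := by rintro rfl; exact hv haT
      by_cases hvb : v = b
      · rw [hvb, Function.update_self]
        rw [hvb] at hv
        rw [if_neg hv] at hx1
        exact hx1 a haT
      · rw [Function.update_of_ne hvb, Function.update_of_ne hva]
        refine hx0 v ?_
        split_ifs
        · simp [hv]
        · exact hv
    · rw [key]
      by_cases hb : b ∈ T
      · rw [if_pos hb] at hx0 hx1
        split_ifs with h1 h2
        · exact hx0 b (by simp)
        · exact hx0 a (by simp)
        · exact hx1 v (by simp [*])
      · rw [if_neg hb] at hx0 hx1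
        split_ifs with h1 h2
        · exact hx0 b hb
        · rw [h2] at hv; exact absurd hv hb
        · exact hx1 v hv

theorem numNonsing_pivot [DecidableEq V] {a b : V} (ha : a ∈ S) (hb : b ∈ S) (hab : G.Adj a b) :
    numNonsing G S = numNonsing G (S.erase a) + numNonsing (pivot G a b) (S.erase b) := by
  classical
  have hne := hab.ne
  have h1 : S.powerset.filter (Nonsing G) = (S.erase a).powerset.filter (Nonsing G) ∪
      S.powerset.filter (fun T => Nonsing G T ∧ a ∈ T) := by
    ext T
    simp only [Finset.mem_union, Finset.mem_filter, Finset.mem_powerset, Finset.subset_erase]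
    tauto
  have h2 : (S.powerset.filter (fun T => Nonsing G T ∧ a ∈ T)).card =
      numNonsing (pivot G a b) (S.erase b) := by
    refine Finset.card_bij' (fun T _ => pivotSet a b T)
      (fun T _ => if a ∈ T then T else insert a (insert b T)) ?_ ?_ ?_ ?_
    · intro T hT
      simp only [Finset.mem_filter, Finset.mem_powerset] at hT ⊢
      refine ⟨?_, (nonsing_pivotSet hab hT.2.2).2 hT.2.1⟩
      unfold pivotSet
      split_ifs with h
      · exact Finset.erase_subset_erase _ ((Finset.erase_subset _ _).trans hT.1)
      · exact Finset.subset_erase.2 ⟨hT.1, h⟩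
    · intro T hT
      simp only [Finset.mem_filter, Finset.mem_powerset, Finset.subset_erase] at hT ⊢
      split_ifs with h
      · refine ⟨hT.1.1, ?_, h⟩
        rw [← nonsing_pivotSet hab h, pivotSet, if_neg hT.1.2]
        exact hT.2
      · refine ⟨Finset.insert_subset ha (Finset.insert_subset hb hT.1.1), ?_, by simp⟩
        rw [← nonsing_pivotSet hab (by simp), pivotSet, if_pos (by simp)]
        convert hT.2 using 1
        ext w
        have := hT.1.2
        simp only [Finset.mem_erase, Finset.mem_insert]
        grind
    · intro T hT
      simp only [Finset.mem_filter, Finset.mem_powerset] at hT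
      have := hT.2.2
      unfold pivotSet
      split_ifs with h1 h2
      · simp at h2
      · ext w
        simp only [Finset.mem_erase, Finset.mem_insert]
        grind
      · rfl
    · intro T hT
      simp only [Finset.mem_filter, Finset.mem_powerset, Finset.subset_erase] at hT
      have := hT.1.2
      unfold pivotSet
      by_cases h1 : a ∈ T
      · simp [h1, this]
      · simp only [h1, if_false]
        rw [if_pos (by simp)]
        ext w
        simp only [Finset.mem_erase, Finset.mem_insert]
        grind
  rw [numNonsing, h1, Finset.card_union_of_disjoint, h2, ← numNonsing]
  rw [Finset.disjoint_left]
  intro T h3 h4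
  simp only [Finset.mem_filter, Finset.mem_powerset, Finset.subset_erase] at h3 h4
  exact h3.1.2 h4.2.2

theorem numNonsing_of_edgeless (h : ∀ a ∈ S, ∀ b ∈ S, ¬ G.Adj a b) : numNonsing G S = 1 := by
  classical
  rw [numNonsing, Finset.card_eq_one]
  refine ⟨∅, ?_⟩
  ext T
  simp only [Finset.mem_filter, Finset.mem_powerset, Finset.mem_singleton]
  constructor
  · rintro ⟨h1, h2⟩
    by_contra hT
    exact not_nonsing_of_edgeless (Finset.nonempty_iff_ne_empty.2 hT)
      (fun a ha b hb => h a (h1 ha) b (h1 hb)) h2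
  · rintro rfl
    exact ⟨by simp, nonsing_empty⟩

/-- The value at `1` of the interlace polynomial counts the vertex sets whose principal submatrix
of the adjacency matrix over `𝔽₂` is nonsingular. -/
theorem eval_one_interlaceOn (G : SimpleGraph V) (S : Finset V) :
    (interlaceOn G S).eval 1 = (numNonsing G S : ℤ) := by
  classical
  induction hn : S.card using Nat.strong_induction_on generalizing G S with
  | _ n ih =>
  by_cases h : ∃ a ∈ S, ∃ b ∈ S, G.Adj a b
  · obtain ⟨a, ha, b, hb, hab⟩ := h
    rw [interlaceOn_of_adj G S ha hb hab, numNonsing_pivot ha hb hab, eval_add,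
      ih _ (hn ▸ Finset.card_erase_lt_of_mem ha) G (S.erase a) rfl,
      ih _ (hn ▸ Finset.card_erase_lt_of_mem hb) (pivot G a b) (S.erase b) rfl]
    push_cast
    ring
  · push Not at h
    rw [interlaceOn_of_not_adj h, numNonsing_of_edgeless h]
    simp

end Nonsingular

/-! ### Edges and connectivity inside a vertex set -/

section Connectivity

variable {V : Type u} {G : SimpleGraph V} {S : Finset V}

open Classical in
/-- The number of edges of `G` with both ends in `S`. -/
noncomputable def edgeCount (G : SimpleGraph V) (S : Finset V) : ℕ :=
  (S.sym2.filter (· ∈ G.edgeSet)).card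

theorem edgeCount_univ [Fintype V] : edgeCount G Finset.univ = G.edgeSet.ncard := by
  classical
  rw [edgeCount, ← Set.ncard_coe_finset]
  congr 1
  ext e
  simp

theorem edgeCount_eq_erase_add [DecidableEq V] {v : V} (hv : v ∈ S) :
    edgeCount G S = edgeCount G (S.erase v) + (nbrs G S v).card := by
  classical
  have h : S.sym2.filter (· ∈ G.edgeSet) = (S.erase v).sym2.filter (· ∈ G.edgeSet) ∪
      (nbrs G S v).image fun w => s(v, w) := by
    ext e
    induction e using Sym2.ind with
    | _ x y =>
    have hirr := G.irrefl (v := v)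
    have hxy := G.adj_comm x y
    simp only [Finset.mem_union, Finset.mem_filter, Finset.mk_mem_sym2_iff, Finset.mem_erase,
      Finset.mem_image, mem_nbrs, SimpleGraph.mem_edgeSet, Sym2.eq_iff]
    constructor
    · rintro ⟨⟨hx, hy⟩, h⟩
      by_cases hxv : x = v
      · subst hxv; exact Or.inr ⟨y, ⟨hy, h⟩, Or.inl ⟨rfl, rfl⟩⟩
      · by_cases hyv : y = v
        · subst hyv; exact Or.inr ⟨x, ⟨hx, h.symm⟩, Or.inr ⟨rfl, rfl⟩⟩
        · exact Or.inl ⟨⟨⟨hxv, hx⟩, hyv, hy⟩, h⟩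
    · rintro (⟨⟨⟨-, hx⟩, -, hy⟩, h⟩ | ⟨w, ⟨hw, h⟩, ⟨rfl, rfl⟩ | ⟨rfl, rfl⟩⟩)
      · exact ⟨⟨hx, hy⟩, h⟩
      · exact ⟨⟨hv, hw⟩, h⟩
      · exact ⟨⟨hw, hv⟩, h.symm⟩
  rw [edgeCount, h, Finset.card_union_of_disjoint, Finset.card_image_of_injective, edgeCount]
  · intro w1 w2 h12
    exact Sym2.congr_right.1 h12
  · rw [Finset.disjoint_left]
    intro e h1 h2
    obtain ⟨w, -, rfl⟩ := Finset.mem_image.1 h2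
    simp at h1

theorem edgeCount_mono {A : Finset V} (h : A ⊆ S) : edgeCount G A ≤ edgeCount G S := by
  classical
  exact Finset.card_le_card (Finset.filter_subset_filter _ (Finset.sym2_mono h))

theorem edgeCount_add_le [DecidableEq V] {A B : Finset V} {u : V} (hA : A ⊆ S) (hB : B ⊆ S)
    (h : ∀ w ∈ A, w ∈ B → w = u) : edgeCount G A + edgeCount G B ≤ edgeCount G S := by
  classical
  rw [edgeCount, edgeCount, edgeCount, ← Finset.card_union_of_disjoint]
  · exact Finset.card_le_card (Finset.union_subset
      (Finset.filter_subset_filter _ (Finset.sym2_mono hA))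
      (Finset.filter_subset_filter _ (Finset.sym2_mono hB)))
  · rw [Finset.disjoint_left]
    intro e h1 h2
    induction e using Sym2.ind with
    | _ x y =>
    simp only [Finset.mem_filter, Finset.mk_mem_sym2_iff, SimpleGraph.mem_edgeSet] at h1 h2
    exact h1.2.ne ((h x h1.1.1 h2.1.1).trans (h y h1.1.2 h2.1.2).symm)

/-- The subgraph of `G` induced on `S` is connected, expressed through cuts: `S` is nonempty and
every proper nonempty subset of `S` is joined by an edge to its complement in `S`. -/
def Conn (G : SimpleGraph V) (S : Finset V) : Prop :=
  S.Nonempty ∧ ∀ A ⊆ S, A.Nonempty → A ≠ S → ∃ a ∈ A, ∃ b ∈ S, b ∉ A ∧ G.Adj a b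

theorem conn_univ [Fintype V] (h : G.Connected) : Conn G Finset.univ := by
  obtain ⟨v₀⟩ := h.nonempty
  refine ⟨⟨v₀, Finset.mem_univ _⟩, fun A _ ⟨a, ha⟩ hA => ?_⟩
  obtain ⟨b, hb⟩ : ∃ b, b ∉ A := by
    by_contra! hc
    exact hA (Finset.eq_univ_iff_forall.2 hc)
  obtain ⟨p⟩ := h.preconnected a b
  obtain ⟨d, -, h1, h2⟩ := p.exists_boundary_dart (A : Set V) ha hb
  exact ⟨d.fst, h1, d.snd, Finset.mem_univ _, h2, d.adj⟩

theorem Conn.nbrs_nonempty (h : Conn G S) {v w : V} (hv : v ∈ S) (hw : w ∈ S) (hvw : w ≠ v) :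
    (nbrs G S v).Nonempty := by
  obtain ⟨a, ha, b, hb, -, hab⟩ := h.2 {v} (by simpa using hv) (by simp) (by
    rintro rfl; exact hvw (by simpa using hw))
  rw [Finset.mem_singleton] at ha
  subst ha
  exact ⟨b, mem_nbrs.2 ⟨hb, hab⟩⟩

/-- Two sides of a cut vertex `u`: a union of components of `S \ {u}` together with `u` is
connected. -/
theorem Conn.insert_of_cut [DecidableEq V] (h : Conn G S) {u : V} (hu : u ∈ S) {A : Finset V}
    (hA : A ⊆ S.erase u) (hcut : ∀ a ∈ A, ∀ b ∈ S.erase u, b ∉ A → ¬ G.Adj a b) :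
    Conn G (insert u A) := by
  have hAS : ∀ x ∈ A, x ∈ S ∧ x ≠ u := fun x hx => by
    have := hA hx
    simp only [Finset.mem_erase] at this
    exact this.symm
  -- a subset of `A` without edges to the rest of `insert u A` has none to the rest of `S`
  have key : ∀ Y ⊆ A, Y.Nonempty → ∃ a ∈ Y, ∃ b ∈ insert u A, b ∉ Y ∧ G.Adj a b := by
    intro Y hY hne
    obtain ⟨a, ha, b, hb, hbY, hab⟩ := h.2 Y (fun y hy => (hAS y (hY hy)).1) hne (by
      rintro rfl; exact (hAS u (hY hu)).2 rfl)
    refine ⟨a, ha, b, ?_, hbY, hab⟩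
    by_contra hc
    simp only [Finset.mem_insert, not_or] at hc
    exact hcut a (hY ha) b (Finset.mem_erase.2 ⟨hc.1, hb⟩) hc.2 hab
  refine ⟨⟨u, by simp⟩, fun X hX hne hXne => ?_⟩
  by_cases huX : u ∈ X
  · obtain ⟨a, ha, b, hb, hbY, hab⟩ := key (insert u A \ X) (by
      intro y hy
      simp only [Finset.mem_sdiff, Finset.mem_insert] at hy
      exact hy.1.resolve_left (by rintro rfl; exact hy.2 huX)) (by
      rw [Finset.sdiff_nonempty]
      exact fun hc => hXne (Finset.Subset.antisymm hX hc))
    simp only [Finset.mem_sdiff] at ha hbY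
    refine ⟨b, by tauto, a, ha.1, ha.2, hab.symm⟩
  · exact key X (fun y hy => (Finset.mem_insert.1 (hX hy)).resolve_left (by
      rintro rfl; exact huX hy)) hne

theorem Conn.union [DecidableEq V] {A B : Finset V} {u : V} (hA : Conn G A) (hB : Conn G B)
    (huA : u ∈ A) (huB : u ∈ B) : Conn G (A ∪ B) := by
  refine ⟨⟨u, Finset.mem_union_left _ huA⟩, fun X hX hne hXne => ?_⟩
  have side : ∀ C ⊆ A ∪ B, Conn G C → (X ∩ C).Nonempty → ¬ C ⊆ X →
      ∃ a ∈ X, ∃ b ∈ A ∪ B, b ∉ X ∧ G.Adj a b := by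
    intro C hC hconn h1 h2
    obtain ⟨a, ha, b, hb, hbX, hab⟩ := hconn.2 (X ∩ C) Finset.inter_subset_right h1 (by
      intro hc; exact h2 (Finset.inter_eq_right.1 hc))
    simp only [Finset.mem_inter] at ha hbX
    exact ⟨a, ha.1, b, hC hb, fun h => hbX ⟨h, hb⟩, hab⟩
  have hAs : A ⊆ A ∪ B := Finset.subset_union_left
  have hBs : B ⊆ A ∪ B := Finset.subset_union_right
  obtain ⟨x, hx⟩ := hne
  have hxAB := Finset.mem_union.1 (hX hx)
  by_cases h1 : A ⊆ X
  · by_cases h2 : B ⊆ X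
    · exact absurd (Finset.Subset.antisymm hX (Finset.union_subset h1 h2)) hXne
    · exact side B hBs hB ⟨u, Finset.mem_inter.2 ⟨h1 huA, huB⟩⟩ h2
  · by_cases h3 : (X ∩ A).Nonempty
    · exact side A hAs hA h3 h1
    · have hxB : x ∈ B := hxAB.resolve_left fun h => h3 ⟨x, Finset.mem_inter.2 ⟨hx, h⟩⟩
      refine side B hBs hB ⟨x, Finset.mem_inter.2 ⟨hx, hxB⟩⟩ fun hc => h3 ?_
      exact ⟨u, Finset.mem_inter.2 ⟨hc huB, huA⟩⟩

/-- If deleting `u` disconnects `S`, then `S` is the union of two connected sets that meet in `u`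
alone and have no edge between them outside `u`. -/
theorem Conn.exists_split [DecidableEq V] (h : Conn G S) {u : V} (hu : u ∈ S)
    (hne : (S.erase u).Nonempty) (hcut : ¬ Conn G (S.erase u)) :
    ∃ A B : Finset V, A ∪ B = S.erase u ∧ Disjoint A B ∧ A.Nonempty ∧ B.Nonempty ∧
      (∀ a ∈ A, ∀ b ∈ B, ¬ G.Adj a b) ∧ Conn G (insert u A) ∧ Conn G (insert u B) := by
  unfold Conn at hcut
  push Not at hcut
  obtain ⟨A, hA, hAne, hAS, hno⟩ := hcut hne
  refine ⟨A, S.erase u \ A, Finset.union_sdiff_of_subset hA, Finset.disjoint_sdiff, hAne, ?_, ?_,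
    h.insert_of_cut hu hA hno, h.insert_of_cut hu Finset.sdiff_subset ?_⟩
  · rw [Finset.sdiff_nonempty]
    exact fun hc => hAS (Finset.Subset.antisymm hA hc)
  · intro a ha b hb
    rw [Finset.mem_sdiff] at hb
    exact hno a ha b hb.1 hb.2
  · intro a ha b hb hbA hab
    rw [Finset.mem_sdiff] at ha hbA
    exact hno b (by tauto) a ha.1 ha.2 hab.symm

/-- A connected set with another vertex than `w` has a vertex other than `w` whose deletion leaves
it connected. -/
theorem Conn.exists_erase [DecidableEq V] (h : Conn G S) {w : V} (hw : w ∈ S)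
    (hne : (S.erase w).Nonempty) : ∃ v ∈ S, v ≠ w ∧ Conn G (S.erase v) := by
  induction hn : S.card using Nat.strong_induction_on generalizing S w with
  | _ n ih =>
  obtain ⟨x, hx⟩ := hne
  have hxw := Finset.ne_of_mem_erase hx
  have hxS := Finset.mem_of_mem_erase hx
  by_cases hc : Conn G (S.erase x)
  · exact ⟨x, hxS, hxw, hc⟩
  have hwx : w ∈ S.erase x := Finset.mem_erase.2 ⟨hxw.symm, hw⟩
  obtain ⟨A, B, hAB, hd, hA, hB, -, hcA, hcB⟩ := h.exists_split hxS ⟨w, hwx⟩ hc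
  -- the side of the cut vertex `x` that does not contain `w`
  obtain ⟨A, B, hAB, hd, hA, hB, hcA, hcB, hwA⟩ : ∃ A B : Finset V, A ∪ B = S.erase x ∧
      Disjoint A B ∧ A.Nonempty ∧ B.Nonempty ∧ Conn G (insert x A) ∧ Conn G (insert x B) ∧
        w ∈ A := by
    rcases Finset.mem_union.1 (hAB ▸ hwx) with hw | hw
    · exact ⟨A, B, hAB, hd, hA, hB, hcA, hcB, hw⟩
    · exact ⟨B, A, by rw [Finset.union_comm, hAB], hd.symm, hB, hA, hcB, hcA, hw⟩
  have hxA : x ∉ A := fun hx =>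
    Finset.notMem_erase x S (hAB ▸ Finset.mem_union_left B hx)
  have hxB : x ∉ B := fun hx =>
    Finset.notMem_erase x S (hAB ▸ Finset.mem_union_right A hx)
  have hS : S = insert x A ∪ insert x B := by
    rw [← Finset.insert_erase hxS, ← hAB]
    ext; simp
  have hlt : (insert x B).card < n := by
    rw [← hn]
    refine Finset.card_lt_card (Finset.ssubset_iff_subset_ne.2 ⟨?_, ?_⟩)
    · rw [hS]; exact Finset.subset_union_right
    · intro hc
      rw [← hc, Finset.mem_insert] at hw
      exact (Finset.disjoint_left.1 hd hwA) (hw.resolve_left hxw.symm)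
  obtain ⟨v, hv, hvx, hcv⟩ := ih _ hlt hcB (Finset.mem_insert_self x B)
    (by rwa [Finset.erase_insert hxB]) rfl
  have hvB : v ∈ B := (Finset.mem_insert.1 hv).resolve_left hvx
  have hvA : v ∉ A := Finset.disjoint_right.1 hd hvB
  refine ⟨v, by rw [hS]; exact Finset.mem_union_right _ hv, by rintro rfl; exact hvA hwA, ?_⟩
  have : S.erase v = insert x A ∪ (insert x B).erase v := by
    rw [hS, Finset.erase_union_distrib, Finset.erase_eq_of_notMem (a := v) (s := insert x A)]
    simp [hvx, hvA]
  rw [this]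
  exact hcA.union hcv (Finset.mem_insert_self x A) (Finset.mem_erase.2 ⟨hvx.symm, by simp⟩)

theorem Conn.edgeCount_pos [DecidableEq V] (h : Conn G S) {v w : V} (hv : v ∈ S) (hw : w ∈ S)
    (hvw : w ≠ v) :
    1 ≤ edgeCount G S := by
  rw [edgeCount_eq_erase_add hv]
  have := (h.nbrs_nonempty hv hw hvw).card_pos
  omega

theorem mem_erase_of_mem_nbrs [DecidableEq V] {v u : V} (hu : u ∈ nbrs G S v) : u ∈ S.erase v := by
  rw [mem_nbrs] at hu
  exact Finset.mem_erase.2 ⟨hu.2.ne.symm, hu.1⟩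

end Connectivity

/-! ### Induced paths -/

section Path

variable {V : Type u} {G : SimpleGraph V} {S : Finset V}

/-- The vertices `f 0, …, f (n - 1)` are distinct, form the set `S`, and induce a path in this
order. -/
structure IsPathOn (G : SimpleGraph V) (S : Finset V) (n : ℕ) (f : ℕ → V) : Prop where
  mem_iff : ∀ v, v ∈ S ↔ ∃ i < n, f i = v
  inj : ∀ i < n, ∀ j < n, f i = f j → i = j
  adj_iff : ∀ i < n, ∀ j < n, (G.Adj (f i) (f j) ↔ i + 1 = j ∨ j + 1 = i)

theorem IsPathOn.reverse {n : ℕ} {f : ℕ → V} (h : IsPathOn G S n f) :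
    IsPathOn G S n fun i => f (n - 1 - i) where
  mem_iff v := by
    rw [h.mem_iff]
    constructor
    · rintro ⟨i, hi, rfl⟩
      exact ⟨n - 1 - i, by omega, by congr 1; omega⟩
    · rintro ⟨i, hi, rfl⟩
      exact ⟨n - 1 - i, by omega, rfl⟩
  inj i hi j hj hij := by
    have := h.inj _ (by omega) _ (by omega) hij
    omega
  adj_iff i hi j hj := by
    rw [h.adj_iff _ (by omega) _ (by omega)]
    omega

/-- Prolonging a path by a vertex whose only neighbour is the last vertex of the path. -/
theorem IsPathOn.snoc [DecidableEq V] {n : ℕ} {f : ℕ → V} {v : V} (hv : v ∈ S)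
    (h : IsPathOn G (S.erase v) (n + 1) f) (hadj : ∀ w ∈ S, G.Adj v w ↔ w = f n) :
    IsPathOn G S (n + 2) (Function.update f (n + 1) v) := by
  have hlt : ∀ i < n + 1, Function.update f (n + 1) v i = f i := fun i hi =>
    Function.update_of_ne (by omega) _ _
  have hmem : ∀ i < n + 1, f i ∈ S ∧ f i ≠ v := fun i hi => by
    have := (h.mem_iff (f i)).2 ⟨i, hi, rfl⟩
    exact ⟨Finset.mem_of_mem_erase this, Finset.ne_of_mem_erase this⟩
  have hvadj : ∀ i < n + 1, (G.Adj v (f i) ↔ i = n) := fun i hi => by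
    rw [hadj _ (hmem i hi).1]
    exact ⟨fun hh => h.inj i hi n (by omega) hh, fun hh => by rw [hh]⟩
  refine ⟨fun w => ?_, fun i hi j hj hij => ?_, fun i hi j hj => ?_⟩
  · by_cases hw : w = v
    · subst hw
      exact ⟨fun _ => ⟨n + 1, by omega, by simp⟩, fun _ => hv⟩
    · have := h.mem_iff w
      simp only [Finset.mem_erase, hw, ne_eq, not_false_eq_true, true_and] at this
      rw [this]
      constructor
      · rintro ⟨i, hi, rfl⟩; exact ⟨i, by omega, hlt i hi⟩
      · rintro ⟨i, hi, hiw⟩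
        by_cases hin : i = n + 1
        · subst hin; simp at hiw; exact absurd hiw.symm hw
        · exact ⟨i, by omega, by rw [← hlt i (by omega), hiw]⟩
  · by_cases h1 : i = n + 1 <;> by_cases h2 : j = n + 1
    · omega
    · rw [h1, Function.update_self, hlt j (by omega)] at hij
      exact absurd hij.symm (hmem j (by omega)).2
    · rw [h2, Function.update_self, hlt i (by omega)] at hij
      exact absurd hij (hmem i (by omega)).2
    · rw [hlt i (by omega), hlt j (by omega)] at hij
      exact h.inj i (by omega) j (by omega) hij
  · by_cases h1 : i = n + 1 <;> by_cases h2 : j = n + 1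
    · rw [h1, h2]; simp
    · rw [h1, Function.update_self, hlt j (by omega), hvadj j (by omega)]
      omega
    · rw [h2, Function.update_self, hlt i (by omega), G.adj_comm, hvadj i (by omega)]
      omega
    · rw [hlt i (by omega), hlt j (by omega)]
      exact h.adj_iff i (by omega) j (by omega)

end Path

/-! ### Fibonacci inequalities -/

theorem fib_add_mul_le (k d : ℕ) :
    Nat.fib (k + 2) + d * Nat.fib (k + 1) ≤ Nat.fib (k + d + 2) := by
  induction d with
  | zero => simp
  | succ d ih =>
    have h1 : Nat.fib (k + (d + 1) + 2) = Nat.fib (k + d + 1) + Nat.fib (k + d + 2) :=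
      Nat.fib_add_two
    have h2 : Nat.fib (k + 1) ≤ Nat.fib (k + d + 1) := Nat.fib_mono (by omega)
    rw [h1, add_mul]
    omega

/-- Both hypotheses are needed: equality holds for `d ≤ 1`, and for `k = 0`, `d = 2`. -/
theorem fib_add_mul_lt {k d : ℕ} (hk : 1 ≤ k) (hd : 2 ≤ d) :
    Nat.fib (k + 2) + d * Nat.fib (k + 1) < Nat.fib (k + d + 2) := by
  obtain ⟨d, rfl⟩ := Nat.exists_eq_add_of_le' hd
  have h0 := fib_add_mul_le k (d + 1)
  have h1 : Nat.fib (k + (d + 2) + 2) = Nat.fib (k + d + 1 + 1) + Nat.fib (k + (d + 1) + 2) :=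
    Nat.fib_add_two
  have h2 : Nat.fib (k + 1 + 1) ≤ Nat.fib (k + d + 1 + 1) := Nat.fib_mono (by omega)
  have h3 : Nat.fib (k + 1) < Nat.fib (k + 1 + 1) := Nat.fib_lt_fib_succ (by omega)
  have h4 : (d + 2) * Nat.fib (k + 1) = (d + 1) * Nat.fib (k + 1) + Nat.fib (k + 1) := by ring
  omega

/-! ### The bounds for connected vertex sets -/

section Bounds

variable {V : Type u} [Fintype V] [DecidableEq V] {G : SimpleGraph V} {S : Finset V}

/-- The bound in terms of the number of edges for a connected set, and the stronger bound after the
deletion of a vertex `u`. The second bound is what makes the induction work: it controls every term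
of the expansion at a vertex whose deletion leaves the set connected. It is never attained when `u`
has at least two neighbours. -/
theorem Conn.numNonsing_le (h : Conn G S) : numNonsing G S ≤ Nat.fib (edgeCount G S + 2) ∧
    ∀ u ∈ S, numNonsing G (S.erase u) ≤ Nat.fib (edgeCount G S + 1) ∧
      (2 ≤ (nbrs G S u).card → numNonsing G (S.erase u) < Nat.fib (edgeCount G S + 1)) := by
  induction hn : S.card using Nat.strong_induction_on generalizing S with
  | _ n ih =>
  have lt : ∀ v ∈ S, (S.erase v).card < n := fun v hv => hn ▸ Finset.card_erase_lt_of_mem hv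
  constructor
  · obtain ⟨w, hw⟩ := h.1
    by_cases hne : (S.erase w).Nonempty
    · obtain ⟨v, hv, hvw, hc⟩ := h.exists_erase hw hne
      obtain ⟨h1, h2⟩ := ih _ (lt v hv) hc rfl
      have h3 := numNonsing_le_of_erase (G := G) (S := S) (v := v)
      have h4 := Finset.sum_le_card_nsmul (nbrs G S v)
        (fun u => numNonsing G ((S.erase v).erase u)) _
        (fun u hu => (h2 u (mem_erase_of_mem_nbrs hu)).1)
      have h5 := fib_add_mul_le (edgeCount G (S.erase v)) (nbrs G S v).card
      rw [edgeCount_eq_erase_add hv]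
      rw [smul_eq_mul] at h4
      omega
    · rw [Finset.not_nonempty_iff_eq_empty] at hne
      rw [numNonsing_of_edgeless]
      · exact Nat.fib_pos.2 (by omega)
      · intro a ha b hb hab
        have : ∀ x ∈ S, x = w := fun x hx => by
          by_contra hxw
          simpa [hne] using Finset.mem_erase.2 ⟨hxw, hx⟩
        exact hab.ne ((this a ha).trans (this b hb).symm)
  · intro u hu
    by_cases hne : (S.erase u).Nonempty
    · obtain ⟨w, hw⟩ := hne
      by_cases hc : Conn G (S.erase u)
      · have h1 := (ih _ (lt u hu) hc rfl).1
        have h2 := (h.nbrs_nonempty hu (Finset.mem_of_mem_erase hw)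
          (Finset.ne_of_mem_erase hw)).card_pos
        have h3 := edgeCount_eq_erase_add (G := G) hu
        refine ⟨h1.trans (Nat.fib_mono (by omega)), fun hd => h1.trans_lt ?_⟩
        refine (Nat.fib_mono (show _ ≤ edgeCount G S by omega)).trans_lt ?_
        exact Nat.fib_lt_fib_succ (by omega)
      · obtain ⟨A, B, hAB, hd, hA, hB, hno, hcA, hcB⟩ := h.exists_split hu ⟨w, hw⟩ hc
        have huA : u ∉ A := fun hx =>
          Finset.notMem_erase u S (hAB ▸ Finset.mem_union_left B hx)
        have huB : u ∉ B := fun hx =>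
          Finset.notMem_erase u S (hAB ▸ Finset.mem_union_right A hx)
        have hAS : insert u A ⊆ S := by
          rw [← Finset.insert_erase hu, ← hAB]
          exact Finset.insert_subset_insert _ Finset.subset_union_left
        have hBS : insert u B ⊆ S := by
          rw [← Finset.insert_erase hu, ← hAB]
          exact Finset.insert_subset_insert _ Finset.subset_union_right
        obtain ⟨a, ha⟩ := hA
        obtain ⟨b, hb⟩ := hB
        have hltA : (insert u A).card < n := by
          rw [← hn]
          refine Finset.card_lt_card (Finset.ssubset_iff_of_subset hAS |>.2 ⟨b, ?_, ?_⟩)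
          · exact hBS (Finset.mem_insert_of_mem hb)
          · rw [Finset.mem_insert, not_or]
            exact ⟨by rintro rfl; exact huB hb, Finset.disjoint_right.1 hd hb⟩
        have hltB : (insert u B).card < n := by
          rw [← hn]
          refine Finset.card_lt_card (Finset.ssubset_iff_of_subset hBS |>.2 ⟨a, ?_, ?_⟩)
          · exact hAS (Finset.mem_insert_of_mem ha)
          · rw [Finset.mem_insert, not_or]
            exact ⟨by rintro rfl; exact huA ha, Finset.disjoint_left.1 hd ha⟩
        have h1 := ((ih _ hltA hcA rfl).2 u (by simp)).1
        have h2 := ((ih _ hltB hcB rfl).2 u (by simp)).1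
        rw [Finset.erase_insert huA] at h1
        rw [Finset.erase_insert huB] at h2
        have h3 := edgeCount_add_le (G := G) hAS hBS (u := u) (by
          intro x hx hx'
          rw [Finset.mem_insert] at hx hx'
          by_contra hxu
          exact Finset.disjoint_left.1 hd (hx.resolve_left hxu) (hx'.resolve_left hxu))
        have eA := hcA.edgeCount_pos (Finset.mem_insert_self u A) (Finset.mem_insert_of_mem ha)
          (by rintro rfl; exact huA ha)
        have eB := hcB.edgeCount_pos (Finset.mem_insert_self u B) (Finset.mem_insert_of_mem hb)
          (by rintro rfl; exact huB hb)
        have hlt : numNonsing G (S.erase u) < Nat.fib (edgeCount G S + 1) := by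
          have h4 := numNonsing_union_le hno
          have h5 := Nat.mul_le_mul h1 h2
          have h6 := Nat.fib_add (edgeCount G (insert u A)) (edgeCount G (insert u B))
          have h7 := Nat.mul_pos (Nat.fib_pos.2 eA) (Nat.fib_pos.2 eB)
          have h8 : Nat.fib (edgeCount G (insert u A) + edgeCount G (insert u B) + 1) ≤
            Nat.fib (edgeCount G S + 1) := Nat.fib_mono (by omega)
          rw [← hAB]
          omega
        exact ⟨hlt.le, fun _ => hlt⟩
    · rw [Finset.not_nonempty_iff_eq_empty] at hne
      have h1 : numNonsing G (S.erase u) = 1 := numNonsing_of_edgeless (by simp [hne])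
      rw [h1]
      refine ⟨Nat.fib_pos.2 (by omega), fun hd => ?_⟩
      obtain ⟨x, hx⟩ := Finset.card_pos.1 (by omega : 0 < (nbrs G S u).card)
      simpa [hne] using mem_erase_of_mem_nbrs hx

/-! ### Equality for connected vertex sets -/

/-- Equality in the expansion at a vertex `v` whose deletion leaves `S` connected forces `v` to have a
single neighbour, and that neighbour to be an end of the path `S \ {v}`. -/
theorem Conn.exists_isPathOn (h : Conn G S)
    (heq : numNonsing G S = Nat.fib (edgeCount G S + 2)) :
    ∃ f, IsPathOn G S (edgeCount G S + 1) f := by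
  induction hn : S.card using Nat.strong_induction_on generalizing S with
  | _ n ih =>
  obtain ⟨w, hw⟩ := h.1
  by_cases hne : (S.erase w).Nonempty
  · obtain ⟨v, hv, hvw, hc⟩ := h.exists_erase hw hne
    obtain ⟨h1, h2⟩ := hc.numNonsing_le
    have h3 := numNonsing_le_of_erase (G := G) (S := S) (v := v)
    have h4 := Finset.sum_le_card_nsmul (nbrs G S v)
      (fun u => numNonsing G ((S.erase v).erase u)) _
      (fun u hu => (h2 u (mem_erase_of_mem_nbrs hu)).1)
    have hd := (h.nbrs_nonempty hv hw hvw.symm).card_pos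
    have he := edgeCount_eq_erase_add (G := G) hv
    rw [smul_eq_mul] at h4
    have hd1 : (nbrs G S v).card = 1 := by
      by_contra hd1
      obtain ⟨x, hx, y, hy, hxy⟩ := Finset.one_lt_card.1 (by omega : 1 < (nbrs G S v).card)
      have hk := hc.edgeCount_pos (mem_erase_of_mem_nbrs hx) (mem_erase_of_mem_nbrs hy) hxy.symm
      have h5 := fib_add_mul_lt hk (by omega : 2 ≤ (nbrs G S v).card)
      rw [he] at heq
      omega
    obtain ⟨u, hu⟩ := Finset.card_eq_one.1 hd1
    have huv : u ∈ nbrs G S v := by simp [hu]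
    have huS := mem_erase_of_mem_nbrs huv
    rw [hu, Finset.sum_singleton] at h3
    rw [hd1] at he
    rw [he] at heq ⊢
    have hfib : Nat.fib (edgeCount G (S.erase v) + 1 + 2) =
        Nat.fib (edgeCount G (S.erase v) + 1) + Nat.fib (edgeCount G (S.erase v) + 2) :=
      Nat.fib_add_two
    obtain ⟨h6, h7⟩ := h2 u huS
    obtain ⟨f, hf⟩ := ih _ (hn ▸ Finset.card_erase_lt_of_mem hv) hc (by omega) rfl
    have hu1 : ¬ 2 ≤ (nbrs G (S.erase v) u).card := fun hc => by
      have := h7 hc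
      omega
    generalize edgeCount G (S.erase v) = m at hf
    obtain ⟨i, hi, rfl⟩ := (hf.mem_iff u).1 huS
    have hadj : ∀ w ∈ S, G.Adj v w ↔ w = f i := fun w hw => by
      rw [← Finset.mem_singleton, ← hu, mem_nbrs]
      exact ⟨fun hh => ⟨hw, hh⟩, fun hh => hh.2⟩
    -- an inner vertex of the path would have two neighbours
    have hends : i = 0 ∨ i = m := by
      by_contra! hc
      refine hu1 (Nat.succ_le_of_lt (Finset.one_lt_card.2 ⟨f (i - 1), ?_, f (i + 1), ?_, ?_⟩))
      · exact mem_nbrs.2 ⟨(hf.mem_iff _).2 ⟨i - 1, by omega, rfl⟩,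
          (hf.adj_iff i hi _ (by omega)).2 (by omega)⟩
      · exact mem_nbrs.2 ⟨(hf.mem_iff _).2 ⟨i + 1, by omega, rfl⟩,
          (hf.adj_iff i hi _ (by omega)).2 (by omega)⟩
      · intro hh
        have := hf.inj _ (by omega) _ (by omega) hh
        omega
    rcases hends with rfl | rfl
    · exact ⟨_, hf.reverse.snoc hv (by simpa using hadj)⟩
    · exact ⟨_, hf.snoc hv hadj⟩
  · rw [Finset.not_nonempty_iff_eq_empty] at hne
    have hall : ∀ x ∈ S, x = w := fun x hx => by
      by_contra hxw
      simpa [hne] using Finset.mem_erase.2 ⟨hxw, hx⟩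
    have hN : numNonsing G S = 1 := numNonsing_of_edgeless fun a ha b hb hab =>
      hab.ne ((hall a ha).trans (hall b hb).symm)
    have he : edgeCount G S = 0 := by
      by_contra h0
      have : Nat.fib 3 ≤ Nat.fib (edgeCount G S + 2) := Nat.fib_mono (by omega)
      rw [← heq, hN] at this
      exact absurd this (by decide)
    rw [he]
    refine ⟨fun _ => w, fun v => ⟨fun hv => ⟨0, by omega, (hall v hv).symm⟩, ?_⟩, ?_, ?_⟩
    · rintro ⟨-, -, rfl⟩; exact hw
    · intro i hi j hj _; omega
    · intro i hi j hj
      have : i = 0 := by omega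
      have : j = 0 := by omega
      simp [*]

/-- The lower bound that makes paths extremal: the last vertex is a leaf, where the expansion is
exact. -/
theorem IsPathOn.fib_le_numNonsing {n : ℕ} {f : ℕ → V} (h : IsPathOn G S n f) :
    Nat.fib (n + 1) ≤ numNonsing G S := by
  induction n using Nat.strong_induction_on generalizing S with
  | _ n ih =>
  have hdel : ∀ (S : Finset V) (n : ℕ), IsPathOn G S (n + 1) f →
      IsPathOn G (S.erase (f n)) n f := fun S n h => by
    refine ⟨fun v => ?_, fun i hi j hj => h.inj i (by omega) j (by omega),
      fun i hi j hj => h.adj_iff i (by omega) j (by omega)⟩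
    rw [Finset.mem_erase, h.mem_iff]
    constructor
    · rintro ⟨hv, i, hi, rfl⟩
      refine ⟨i, ?_, rfl⟩
      by_contra hc
      obtain rfl : i = n := by omega
      exact hv rfl
    · rintro ⟨i, hi, rfl⟩
      refine ⟨fun hc => ?_, i, by omega, rfl⟩
      have := h.inj i (by omega) n (by omega) hc
      omega
  match n, ih, h with
  | 0, _, _ => exact numNonsing_pos
  | 1, _, _ => exact numNonsing_pos
  | n + 2, ih, h =>
    have h1 := hdel _ _ h
    have h2 := hdel _ _ h1
    have h3 := le_numNonsing_of_leaf (G := G) (S := S) (v := f (n + 1)) (u := f n)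
      ((h.mem_iff _).2 ⟨n + 1, by omega, rfl⟩) ((h.mem_iff _).2 ⟨n, by omega, rfl⟩)
      ((h.adj_iff _ (by omega) _ (by omega)).2 (by omega)) (by
        intro w hw hadj
        obtain ⟨i, hi, rfl⟩ := (h.mem_iff w).1 hw
        rw [h.adj_iff _ (by omega) _ hi] at hadj
        congr 1
        omega)
    have h4 := ih (n + 1) (by omega) h1
    have h5 := ih n (by omega) h2
    have h6 : Nat.fib (n + 2 + 1) = Nat.fib (n + 1) + Nat.fib (n + 1 + 1) := Nat.fib_add_two
    omega

/-! ### The bound for arbitrary vertex sets -/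

/-- The expansion at `v`, estimated by the bound `2 ^ m` for smaller vertex sets. -/
theorem numNonsing_le_succ_mul {v : V}
    (h : ∀ T ⊆ S.erase v, numNonsing G T ≤ 2 ^ edgeCount G T) :
    numNonsing G S ≤ ((nbrs G S v).card + 1) * 2 ^ edgeCount G (S.erase v) := by
  have h1 := numNonsing_le_of_erase (G := G) (S := S) (v := v)
  have h2 := Finset.sum_le_card_nsmul (nbrs G S v)
    (fun u => numNonsing G ((S.erase v).erase u)) (2 ^ edgeCount G (S.erase v))
    (fun u _ => (h _ (Finset.erase_subset _ _)).trans
      (Nat.pow_le_pow_right (by norm_num) (edgeCount_mono (Finset.erase_subset _ _))))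
  have h3 := h _ (Finset.Subset.refl (S.erase v))
  rw [smul_eq_mul] at h2
  rw [add_mul]
  omega

theorem numNonsing_le_two_pow : numNonsing G S ≤ 2 ^ edgeCount G S := by
  induction hn : S.card using Nat.strong_induction_on generalizing S with
  | _ n ih =>
  obtain rfl | ⟨v, hv⟩ := S.eq_empty_or_nonempty
  · rw [numNonsing_of_edgeless (by simp)]
    exact Nat.one_le_two_pow
  · have h := numNonsing_le_succ_mul (G := G) (S := S) (v := v) fun T hT =>
      ih _ (hn ▸ (Finset.card_le_card hT).trans_lt (Finset.card_erase_lt_of_mem hv)) rfl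
    rw [edgeCount_eq_erase_add hv, pow_add, mul_comm (2 ^ _)]
    exact h.trans (Nat.mul_le_mul_right _ Nat.lt_two_pow_self)

/-- Equality in `numNonsing_le_two_pow` needs `d + 1 = 2 ^ d` for the degree `d` of every vertex. -/
theorem card_nbrs_le_one (h : numNonsing G S = 2 ^ edgeCount G S) {v : V} (hv : v ∈ S) :
    (nbrs G S v).card ≤ 1 := by
  have h1 := numNonsing_le_succ_mul (G := G) (S := S) (v := v) fun _ _ => numNonsing_le_two_pow
  rw [h, edgeCount_eq_erase_add hv, pow_add, mul_comm (2 ^ _)] at h1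
  have h2 := Nat.le_of_mul_le_mul_right h1 (by positivity)
  by_contra hd
  obtain ⟨d, hd⟩ := Nat.exists_eq_add_of_le' (show 2 ≤ (nbrs G S v).card by omega)
  rw [hd, pow_succ] at h2
  have h3 : d + 1 < 2 ^ (d + 1) := Nat.lt_two_pow_self
  omega

theorem two_pow_le_numNonsing (h : ∀ v ∈ S, (nbrs G S v).card ≤ 1) :
    2 ^ edgeCount G S ≤ numNonsing G S := by
  induction hn : S.card using Nat.strong_induction_on generalizing S with
  | _ n ih =>
  have mono : ∀ T ⊆ S, ∀ v ∈ T, (nbrs G T v).card ≤ 1 := fun T hT v hv =>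
    (Finset.card_le_card (fun w hw => mem_nbrs.2 ⟨hT (mem_nbrs.1 hw).1, (mem_nbrs.1 hw).2⟩)).trans
      (h v (hT hv))
  by_cases hedge : ∃ v ∈ S, ∃ u ∈ S, G.Adj v u
  · obtain ⟨v, hv, u, hu, huv⟩ := hedge
    have uniq : ∀ x ∈ S, ∀ y ∈ S, ∀ z ∈ S, G.Adj x y → G.Adj x z → z = y :=
      fun x hx y hy z hz hxy hxz =>
        Finset.card_le_one.1 (h x hx) z (mem_nbrs.2 ⟨hz, hxz⟩) y (mem_nbrs.2 ⟨hy, hxy⟩)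
    have huS : u ∈ S.erase v := Finset.mem_erase.2 ⟨huv.ne.symm, hu⟩
    have sub1 := Finset.erase_subset v S
    have sub2 := (Finset.erase_subset u _).trans sub1
    have lt1 := Finset.card_erase_lt_of_mem hv
    have lt2 := (Finset.card_erase_lt_of_mem huS).trans lt1
    have h1 := ih _ (hn ▸ lt1) (mono _ sub1) rfl
    have h2 := ih _ (hn ▸ lt2) (mono _ sub2) rfl
    have h3 := le_numNonsing_of_leaf hv hu huv fun w hw => uniq v hv u hu w hw huv
    have h4 : (nbrs G S v).card = 1 := le_antisymm (h v hv)
      (Finset.card_pos.2 ⟨u, mem_nbrs.2 ⟨hu, huv⟩⟩)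
    have h5 : (nbrs G (S.erase v) u).card = 0 := by
      rw [Finset.card_eq_zero, Finset.eq_empty_iff_forall_notMem]
      intro w hw
      obtain ⟨hw1, hw2⟩ := mem_nbrs.1 hw
      exact Finset.ne_of_mem_erase hw1 (uniq u hu v hv w (sub1 hw1) huv.symm hw2)
    have h6 := edgeCount_eq_erase_add (G := G) hv
    have h7 := edgeCount_eq_erase_add (G := G) huS
    rw [h5, add_zero] at h7
    rw [h6, h4, pow_succ]
    rw [← h7] at h2
    omega
  · push Not at hedge
    have : edgeCount G S = 0 := by
      rw [edgeCount, Finset.card_eq_zero, Finset.eq_empty_iff_forall_notMem]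
      intro e
      induction e using Sym2.ind with
      | _ x y =>
      simp only [Finset.mem_filter, Finset.mk_mem_sym2_iff, SimpleGraph.mem_edgeSet]
      exact fun hh => hedge x hh.1.1 y hh.1.2 hh.2
    rw [this]
    exact numNonsing_pos

end Bounds

/-! ### Bounds for graphs -/

section Graph

variable {V : Type u} [Fintype V] {G : SimpleGraph V}

theorem eval_one_interlacePolynomial (G : SimpleGraph V) :
    (interlacePolynomial G).eval 1 = (numNonsing G Finset.univ : ℤ) :=
  eval_one_interlaceOn G Finset.univ

theorem eval_one_le_fib (h : G.Connected) :
    (interlacePolynomial G).eval 1 ≤ (Nat.fib (G.edgeSet.ncard + 2) : ℤ) := by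
  classical
  rw [eval_one_interlacePolynomial, ← edgeCount_univ]
  exact_mod_cast (conn_univ h).numNonsing_le.1

theorem eval_one_eq_fib_iff (h : G.Connected) :
    (interlacePolynomial G).eval 1 = (Nat.fib (G.edgeSet.ncard + 2) : ℤ) ↔
      Nonempty (G ≃g SimpleGraph.pathGraph (G.edgeSet.ncard + 1)) := by
  classical
  constructor
  · intro heq
    rw [eval_one_interlacePolynomial, ← edgeCount_univ] at heq
    obtain ⟨f, hf⟩ := (conn_univ h).exists_isPathOn (by exact_mod_cast heq)
    rw [edgeCount_univ] at hf
    have hbij : Function.Bijective fun i : Fin (G.edgeSet.ncard + 1) => f i := by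
      refine ⟨fun i j hij => Fin.ext (hf.inj i i.2 j j.2 hij), fun v => ?_⟩
      obtain ⟨i, hi, rfl⟩ := (hf.mem_iff v).1 (Finset.mem_univ v)
      exact ⟨⟨i, hi⟩, rfl⟩
    refine ⟨RelIso.symm ⟨Equiv.ofBijective _ hbij, ?_⟩⟩
    intro i j
    rw [SimpleGraph.pathGraph_adj]
    exact hf.adj_iff i i.2 j j.2
  · rintro ⟨φ⟩
    refine le_antisymm (eval_one_le_fib h) ?_
    rw [eval_one_interlacePolynomial]
    have hlt : ∀ i, i < G.edgeSet.ncard + 1 → Fin.ofNat (G.edgeSet.ncard + 1) i = i :=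
      fun i hi => Nat.mod_eq_of_lt hi
    have hf : IsPathOn G Finset.univ (G.edgeSet.ncard + 1)
        fun i => φ.symm (Fin.ofNat (G.edgeSet.ncard + 1) i) := by
      refine ⟨fun v => ?_, fun i hi j hj hij => ?_, fun i hi j hj => ?_⟩
      · simp only [Finset.mem_univ, true_iff]
        refine ⟨φ v, (φ v).2, ?_⟩
        rw [RelIso.symm_apply_eq]
        exact Fin.ext (hlt _ (φ v).2)
      · have := congrArg Fin.val (φ.symm.injective hij)
        rwa [hlt i hi, hlt j hj] at this
      · rw [φ.symm.map_adj_iff, SimpleGraph.pathGraph_adj, hlt i hi, hlt j hj]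
    exact_mod_cast hf.fib_le_numNonsing

/-- The number of nonsingular sets is at most the product of the numbers for the components, and each
component obeys `eval_one_le_fib`. -/
theorem eval_one_le_prod (G : SimpleGraph V) [Fintype G.ConnectedComponent] :
    (interlacePolynomial G).eval 1 ≤
      ∏ c : G.ConnectedComponent, (Nat.fib (c.toSimpleGraph.edgeSet.ncard + 2) : ℤ) := by
  classical
  have key : ∀ s : Finset G.ConnectedComponent,
      numNonsing G (Finset.univ.filter fun v => G.connectedComponentMk v ∈ s) ≤
        ∏ c ∈ s, numNonsing G (Finset.univ.filter fun v => G.connectedComponentMk v = c) := by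
    intro s
    induction s using Finset.induction_on with
    | empty => exact (numNonsing_of_edgeless (by simp)).le
    | insert c s hc ih =>
      rw [Finset.prod_insert hc]
      simp only [Finset.mem_insert]
      rw [Finset.filter_or]
      refine (numNonsing_union_le ?_).trans (Nat.mul_le_mul_left _ ih)
      intro a ha b hb hab
      simp only [Finset.mem_filter, Finset.mem_univ, true_and] at ha hb
      rw [← SimpleGraph.ConnectedComponent.connectedComponentMk_eq_of_adj hab, ha] at hb
      exact hc hb
  have h := key Finset.univ
  simp only [Finset.mem_univ, Finset.filter_true] at h
  rw [eval_one_interlacePolynomial]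
  refine (Nat.cast_le.2 h).trans ?_
  push_cast
  refine Finset.prod_le_prod (fun _ _ => by positivity) fun c _ => ?_
  let _ : Fintype c.supp := Fintype.ofFinite _
  have h1 : (interlacePolynomial (G.induce c.supp)).eval 1 ≤ _ :=
    eval_one_le_fib c.connected_toSimpleGraph
  refine le_of_eq_of_le ?_ h1
  rw [interlacePolynomial_induce, eval_one_interlaceOn]
  congr 2
  ext v
  simp

theorem eval_one_le_two_pow (G : SimpleGraph V) :
    (interlacePolynomial G).eval 1 ≤ 2 ^ G.edgeSet.ncard := by
  classical
  rw [eval_one_interlacePolynomial, ← edgeCount_univ]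
  exact_mod_cast numNonsing_le_two_pow

theorem eval_one_eq_two_pow_iff (G : SimpleGraph V) :
    (interlacePolynomial G).eval 1 = 2 ^ G.edgeSet.ncard ↔
      ∀ e ∈ G.edgeSet, ∀ f ∈ G.edgeSet, e ≠ f → ∀ v, ¬ (v ∈ e ∧ v ∈ f) := by
  classical
  rw [eval_one_interlacePolynomial, ← edgeCount_univ]
  constructor
  · rintro heq e he f hf hef v ⟨hve, hvf⟩
    have h := card_nbrs_le_one (G := G) (by exact_mod_cast heq) (Finset.mem_univ v)
    obtain ⟨x, rfl⟩ := hve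
    obtain ⟨y, rfl⟩ := hvf
    rw [SimpleGraph.mem_edgeSet] at he hf
    refine hef (congrArg _ (Finset.card_le_one.1 h x ?_ y ?_)) <;> simp [mem_nbrs, *]
  · intro h
    have h1 := two_pow_le_numNonsing (G := G) (S := Finset.univ) fun v _ => by
      refine Finset.card_le_one.2 fun x hx y hy => ?_
      by_contra hxy
      exact h s(v, x) (mem_nbrs.1 hx).2 s(v, y) (mem_nbrs.1 hy).2
        (fun hc => hxy (Sym2.congr_right.1 hc)) v ⟨by simp, by simp⟩
    exact_mod_cast le_antisymm numNonsing_le_two_pow h1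

end Graph

end InterlacePoly

/-- Upper bounds for `q_G(1)` in terms of the size of `G`. Here `G.edgeSet.ncard` is the number of
edges of `G`, `c.toSimpleGraph` is the component `c` of `G` as a graph, and
`SimpleGraph.pathGraph (m + 1)` is the path with `m` edges. -/
theorem proposition49 {V : Type u} [Fintype V] [DecidableEq V] (G : SimpleGraph V)
    [DecidableRel G.Adj] :
    (G.Connected →
      (InterlacePoly.interlacePolynomial G).eval 1 ≤ (Nat.fib (G.edgeSet.ncard + 2) : ℤ) ∧
      ((InterlacePoly.interlacePolynomial G).eval 1 = (Nat.fib (G.edgeSet.ncard + 2) : ℤ) ↔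
        Nonempty (G ≃g SimpleGraph.pathGraph (G.edgeSet.ncard + 1)))) ∧
    (InterlacePoly.interlacePolynomial G).eval 1 ≤
      ∏ c : G.ConnectedComponent, (Nat.fib (c.toSimpleGraph.edgeSet.ncard + 2) : ℤ) ∧
    (InterlacePoly.interlacePolynomial G).eval 1 ≤ 2 ^ G.edgeSet.ncard ∧
    ((InterlacePoly.interlacePolynomial G).eval 1 = 2 ^ G.edgeSet.ncard ↔
      ∀ e ∈ G.edgeSet, ∀ f ∈ G.edgeSet, e ≠ f → ∀ v, ¬ (v ∈ e ∧ v ∈ f)) :=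
  ⟨fun h => ⟨InterlacePoly.eval_one_le_fib h, InterlacePoly.eval_one_eq_fib_iff h⟩,
    InterlacePoly.eval_one_le_prod G, InterlacePoly.eval_one_le_two_pow G,
    InterlacePoly.eval_one_eq_two_pow_iff G⟩
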